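/- All varieties are over $\mathbb C$. Let $\mathbb J$ be a finite-dimensional unital commutative complex Jordan algebra (a commutative algebra with unit $e$ such that $x^2(yx)=(x^2y)x$ for all $x,y$) of rank three, i.e. such that for a general $x\in\mathbb J$ the span $\mathbb C[x]$ of the powers $x^k$, $k\geq 0$, has dimension $3$. Let $$x^3-\sigma_1(x)x^2+\sigma_2(x)x-\sigma_3(x)e=0$$ be its generic minimum polynomial: the $\sigma_i$ are the polynomial functions on $\mathbb J$ such that, for general $x$, the minimal polynomial of the multiplication by $x$ on $\mathbb C[x]$ is $\lambda^3-\sigma_1(x)\lambda^2+\sigma_2(x)\lambda-\sigma_3(x)$. Put $N(x)=\sigma_3(x)$ and $x^\#=x^2-\sigma_1(x)x+\sigma_2(x)e$. Let $\mathcal Z_2(\mathbb J)=\left\{\begin{pmatrix}s&x\\y&t\end{pmatrix} : s,t\in\mathbb C,\ x,y\in\mathbb J\right\}$, and let the twisted cubic $X^3_{\mathbb J}\subset\mathbb P(\mathcal Z_2(\mathbb J))$ be the Zariski closure of the set of points $$\begin{bmatrix}1&x\\x^\#&N(x)\end{bmatrix},\qquad x\in\mathbb J.$$ Then $X^3_{\mathbb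 J}$ is $3$-covered by rational normal curves of degree $3$: through three general points of $X^3_{\mathbb J}$ (i.e. for all triples in a non-empty Zariski open subset of $(X^3_{\mathbb J})^3$) there passes a rational normal curve of degree $3$ contained in $X^3_{\mathbb J}$. Moreover $X^3_{\mathbb J}$ is an $\overline X(\dim\mathbb J,3,3)$. Here, for integers $r\geq 1$, $n\geq 2$ and $\delta\geq n-1$, an $\overline X(r+1,n,\delta)$ is an irreducible non-degenerate projective variety $X\subset\mathbb P^{\overline\pi(r,n,\delta)-1}$ of dimension $r+1$ that is $n$-covered by irreducible curves of degree $\delta$ (through $n$ general points of $X$ there passes an irreducible curve of degree $\delta$ contained in $X$), where $$\overline\pi(r,n,\delta)=m\binom{r+\rho+1}{r+1}+m'\binom{r+\rho}{r+1},\quad \rho=\Big\lfloor\frac{\delta}{n-1}\Big\rfloor,\quad m=\delta-\rho(n-1)+1,\quad m'=n-1-m.$$ So $X^3_{\mathbb J}$ is an irreducible non-degenerate projective variety of dimension $k=\dim\mathbb J$ in the projective space $\mathbb P(\mathcal Z_2(\mathbb J))$ of dimension $2k+1=\overline\pi(k-1,3,3)-1$. -/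

import Mathlib

open scoped LinearAlgebra.Projectivization Topology

noncomputable section

/-! ## Zariski topologies -/

section Zariski

variable (V : Type*) [AddCommGroup V] [Module ℂ V]

/-- The algebra of polynomial functions on a (finite-dimensional) complex vector space:
the algebra of functions generated by the linear forms. -/
def polyFun : Subalgebra ℂ (V → ℂ) :=
  Algebra.adjoin ℂ (Set.range fun l : Module.Dual ℂ V => (l : V → ℂ))

/-- The Zariski topology of a finite-dimensional complex vector space, regarded as an affine
space. -/
abbrev affineZariski : TopologicalSpace V :=
  TopologicalSpace.generateFrom {U | ∃ f ∈ polyFun V, U = {x | f x ≠ 0}}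

/-- A property holds for the general element of `V` if it holds on a non-empty Zariski open
subset of `V`. -/
def ForGeneral {V : Type*} [AddCommGroup V] [Module ℂ V] (P : V → Prop) : Prop :=
  ∃ U : Set V, IsOpen[affineZariski V] U ∧ U.Nonempty ∧ ∀ x ∈ U, P x

/-- `f` is a homogeneous polynomial function of degree `d` on `V`. -/
def IsHomogeneousPoly {V : Type*} [AddCommGroup V] [Module ℂ V] (d : ℕ) (f : V → ℂ) : Prop :=
  f ∈ polyFun V ∧ ∀ (c : ℂ) (v : V), f (c • v) = c ^ d * f v

/-- `f` is a multihomogeneous polynomial function of multidegree `d` on `V ^ n`. -/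
def IsMultihomogeneousPoly {V : Type*} [AddCommGroup V] [Module ℂ V] {n : ℕ} (d : Fin n → ℕ)
    (f : (Fin n → V) → ℂ) : Prop :=
  f ∈ polyFun (Fin n → V) ∧
    ∀ (c : Fin n → ℂ) (v : Fin n → V), f (fun i => c i • v i) = (∏ i, c i ^ d i) * f v

/-- The Zariski topology of the projective space `ℙ(V)` of lines of `V`. The non-vanishing of a
homogeneous polynomial at a point does not depend on the chosen representative. -/
abbrev projZariski : TopologicalSpace (ℙ ℂ V) :=
  TopologicalSpace.generateFrom
    {U | ∃ (d : ℕ) (f : V → ℂ), IsHomogeneousPoly d f ∧ U = {p | f p.rep ≠ 0}}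

/-- The Zariski topology of the product variety `ℙ(V) ^ n` (finer than the product of the Zariski
topologies of the factors): its closed sets are the zero loci of multihomogeneous polynomials. -/
abbrev tupleZariski (n : ℕ) : TopologicalSpace (Fin n → ℙ ℂ V) :=
  TopologicalSpace.generateFrom
    {U | ∃ (d : Fin n → ℕ) (f : (Fin n → V) → ℂ), IsMultihomogeneousPoly d f ∧
      U = {p | f (fun i => (p i).rep) ≠ 0}}

end Zariski

/-! ## Projective varieties, curves and covering families -/

section Varieties

variable {V : Type*} [AddCommGroup V] [Module ℂ V]

/-- `X ⊆ ℙ(V)` is an irreducible projective variety. -/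
def IsProjVariety (X : Set (ℙ ℂ V)) : Prop :=
  IsClosed[projZariski V] X ∧ @IsIrreducible _ (projZariski V) X

/-- The dimension of a subset of `ℙ(V)`: the Krull dimension for the induced Zariski topology. -/
def projDim (X : Set (ℙ ℂ V)) : WithBot ℕ∞ :=
  @topologicalKrullDim X ((projZariski V).induced Subtype.val)

/-- `X` spans `ℙ(V)`. -/
def IsNondegenerate (X : Set (ℙ ℂ V)) : Prop :=
  Projectivization.Subspace.span X = ⊤

/-- `C` is an irreducible projective curve of degree `δ` in `ℙ(V)`: an irreducible projective
variety of dimension one that meets the general hyperplane in exactly `δ` points. -/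
def IsIrreducibleCurve (δ : ℕ) (C : Set (ℙ ℂ V)) : Prop :=
  IsProjVariety C ∧ projDim C = 1 ∧
    ForGeneral fun l : Module.Dual ℂ V => {p ∈ C | l p.rep = 0}.encard = δ

/-- `C` is a rational normal curve of degree `δ` in `ℙ(V)`: the image of the standard one
`[a : b] ↦ [a ^ δ : a ^ (δ - 1) b : … : b ^ δ]` of `ℙ^δ` under a linear embedding
`ℙ^δ → ℙ(V)`. -/
def IsRationalNormalCurve (δ : ℕ) (C : Set (ℙ ℂ V)) : Prop :=
  ∃ L : (Fin (δ + 1) → ℂ) →ₗ[ℂ] V, Function.Injective L ∧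
    C = {p | ∃ a b : ℂ, (a ≠ 0 ∨ b ≠ 0) ∧
      p.submodule = Submodule.span ℂ {L fun i => a ^ (δ - (i : ℕ)) * b ^ (i : ℕ)}}

/-- `X` is `n`-covered by curves of the class `𝒞`: through `n` general points of `X` (that is, for
all members of a non-empty Zariski open subset of `X ^ n`) there passes a curve that belongs to
`𝒞` and is contained in `X`. -/
def IsCoveredBy (n : ℕ) (𝒞 : Set (ℙ ℂ V) → Prop) (X : Set (ℙ ℂ V)) : Prop :=
  ∃ U : Set (Fin n → ℙ ℂ V), IsOpen[tupleZariski V n] U ∧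
    (∃ p ∈ U, ∀ i, p i ∈ X) ∧
    ∀ p ∈ U, (∀ i, p i ∈ X) → ∃ C : Set (ℙ ℂ V), 𝒞 C ∧ C ⊆ X ∧ ∀ i, p i ∈ C

/-- The number `π̄(r, n, δ) = m * C(r+ρ+1, r+1) + m' * C(r+ρ, r+1)`, with `ρ = ⌊δ / (n-1)⌋`,
`m = δ - ρ (n-1) + 1` and `m' = n - 1 - m`, for `n ≥ 2` and `δ ≥ n - 1`. -/
def piBar (r n δ : ℕ) : ℕ :=
  (δ - δ / (n - 1) * (n - 1) + 1) * (r + δ / (n - 1) + 1).choose (r + 1) +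
    (n - 1 - (δ - δ / (n - 1) * (n - 1) + 1)) * (r + δ / (n - 1)).choose (r + 1)

/-- `X ⊆ ℙ(V)` is an `X̄(k, n, δ)`, where `k = r + 1` with `r ≥ 1`: an irreducible non-degenerate
projective variety of dimension `k` in a projective space of dimension `π̄(r, n, δ) - 1` that is
`n`-covered by irreducible curves of degree `δ`. -/
structure IsXBar (k n δ : ℕ) (X : Set (ℙ ℂ V)) : Prop where
  two_le_dim : 2 ≤ k
  two_le_points : 2 ≤ n
  le_degree : n - 1 ≤ δ
  variety : IsProjVariety X
  dim_eq : projDim X = k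
  nondegenerate : IsNondegenerate X
  covered : IsCoveredBy n (IsIrreducibleCurve δ) X
  finrank_ambient : Module.finrank ℂ V = piBar (k - 1) n δ

end Varieties

/-! ## Jordan algebras -/

section Jordan

variable {J : Type*} [NonAssocCommRing J] [Module ℂ J] [SMulCommClass ℂ J J]

/-- The powers `x ^ 0 = e`, `x ^ (k + 1) = x * x ^ k`. -/
def jordanPow (x : J) : ℕ → J
  | 0 => 1
  | k + 1 => x * jordanPow x k

/-- The subspace `ℂ[x]` spanned by the powers of `x`. -/
def powerSpan (x : J) : Submodule ℂ J :=
  Submodule.span ℂ (Set.range (jordanPow x))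

lemma mulLeft_mem_powerSpan (x : J) :
    ∀ y ∈ powerSpan x, LinearMap.mulLeft ℂ x y ∈ powerSpan x := by
  intro y hy
  refine Submodule.span_induction (p := fun y _ => LinearMap.mulLeft ℂ x y ∈ powerSpan x)
    ?_ ?_ ?_ ?_ hy
  · rintro _ ⟨k, rfl⟩
    exact Submodule.subset_span ⟨k + 1, rfl⟩
  · simp
  · intro a b _ _ ha hb
    rw [map_add]
    exact Submodule.add_mem _ ha hb
  · intro c a _ ha
    rw [map_smul]
    exact Submodule.smul_mem _ c ha

/-- The restriction `ℓ_x` of the multiplication by `x` to `ℂ[x]`. -/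
def mulRestrict (x : J) : powerSpan x →ₗ[ℂ] powerSpan x :=
  (LinearMap.mulLeft ℂ x).restrict (mulLeft_mem_powerSpan x)

variable (J) in
/-- `J` has rank `m`: the subalgebra `ℂ[x]` has dimension `m` for a general `x`. -/
def HasJordanRank (m : ℕ) : Prop :=
  ForGeneral fun x : J => Module.finrank ℂ (powerSpan x) = m

/-- The coefficient `σ_i` of the generic minimum polynomial
`x ^ m - σ_1(x) x ^ (m - 1) + … + (-1) ^ m σ_m(x)`: the (unique, and existing whenever `J` is
finite-dimensional and has a rank `m ≥ i`) polynomial function on `J` whose value at a general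
`x` is, up to the sign `(-1) ^ i`, the coefficient of degree `m - i` of the minimal polynomial
(of degree `m`) of `ℓ_x`. -/
def genericCoeff (i : ℕ) : J → ℂ :=
  Classical.epsilon fun σ : J → ℂ => σ ∈ polyFun J ∧
    ForGeneral fun x : J => i ≤ (minpoly ℂ (mulRestrict x)).natDegree ∧
      σ x = (-1) ^ i *
        (minpoly ℂ (mulRestrict x)).coeff ((minpoly ℂ (mulRestrict x)).natDegree - i)

/-- The generic norm `N = σ_3` of a Jordan algebra of rank three. -/
def cubicNorm (x : J) : ℂ := genericCoeff 3 x

/-- The adjoint `x^# = x ^ 2 - σ_1(x) x + σ_2(x) e` in a Jordan algebra of rank three. -/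
def cubicAdjoint (x : J) : J :=
  x * x - genericCoeff 1 x • x + genericCoeff 2 x • (1 : J)

variable (J) in
/-- The space of Zorn matrices with rows `(s, x)` and `(y, t)`, for `s, t ∈ ℂ` and `x, y ∈ J`,
written as quadruples `(s, x, y, t)`. -/
abbrev ZornMatrices : Type _ := ℂ × J × J × ℂ

/-- The map `ν_3 : J → ℙ(Z_2(J))` that sends `x` to the class of the Zorn matrix with rows
`(1, x)` and `(x^#, N(x))`. -/
def nuThree (x : J) : ℙ ℂ (ZornMatrices J) :=
  Projectivization.mk ℂ ((1, x, cubicAdjoint x, cubicNorm x) : ZornMatrices J)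
    (fun h => one_ne_zero (congrArg Prod.fst h))

variable (J) in
/-- The twisted cubic `X³_J` over a Jordan algebra of rank three: the Zariski closure of the image
of `ν_3`. -/
def twistedCubic : Set (ℙ ℂ (ZornMatrices J)) :=
  closure[projZariski (ZornMatrices J)] (Set.range (nuThree (J := J)))

end Jordan

end

/-! The twisted cubic over `J` behaves like the ordinary one because inversion in `J` is linear on
Zorn matrices. Write `ν(x) = (1, x, x^#, N(x))`. When `N(w) ≠ 0`, `ν(w)` is `N(w)` times `(N(w⁻¹),
(w⁻¹)^#, w⁻¹, 1)`, so `w ↦ w⁻¹` reverses the four entries, and translations act linearly because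
`^#` and `N` have addition formulas. Hence `w ↦ x₀ + w⁻¹` is induced by an injective linear map
(`inverseTranslation`), under which the equations of `X³_J` still vanish on `ν(J)`. For general `x₀,
x₁, x₂` put `a = (x₁ - x₀)⁻¹` and `b = (x₂ - x₀)⁻¹`. The line through `a` and `b` is sent by `ν` to
a twisted cubic curve through the point `(0, 0, 0, 1)`, nondegenerate in its `ℙ³` when `N(b - a) ≠
0`. The linear map carries this curve into `X³_J` and through the three points
(`IsCubicTrace.exists_rationalNormalCurve`).

The required identities come from the generic trace. A priori the `σ_i` are only rational functions;
Gauss's lemma makes them polynomial, since the minimum polynomial divides the characteristic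
polynomial of multiplication by the generic element (`exists_generic_relation`). Differentiating the
minimum relation then shows that `σ₁ = τ` is linear, that `τ(e) = 3`, that `σ₂` is given by Newton's
identity and that `τ` is associative, the last because commutators of multiplications are
derivations (`exists_generic_trace`). From this follow `x^## = N(x) x` and the expansion of `N(x +
y)`.

The dimension is bounded above by the number of algebraically independent functions on the
parametrized cone and below by a flag of coordinate subspaces. Non-degeneracy follows from the
different degrees of the entries of `ν`, and a twisted cubic curve has degree three because a
general hyperplane cuts it in the roots of a separable cubic. -/

noncomputable section

/-! ### Polynomial functions, polynomial maps and generic properties. -/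

section PolynomialFunctions

variable {V W : Type*} [AddCommGroup V] [Module ℂ V] [AddCommGroup W] [Module ℂ W]

lemma dual_mem_polyFun (l : Module.Dual ℂ V) : (fun v => l v) ∈ polyFun V :=
  Algebra.subset_adjoin ⟨l, rfl⟩

lemma const_mem_polyFun (c : ℂ) : (fun _ : V => c) ∈ polyFun V :=
  (polyFun V).algebraMap_mem c

lemma add_mem_polyFun {f g : V → ℂ} (hf : f ∈ polyFun V) (hg : g ∈ polyFun V) :
    (fun v => f v + g v) ∈ polyFun V := (polyFun V).add_mem hf hg

lemma sub_mem_polyFun {f g : V → ℂ} (hf : f ∈ polyFun V) (hg : g ∈ polyFun V) :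
    (fun v => f v - g v) ∈ polyFun V := (polyFun V).sub_mem hf hg

lemma mul_mem_polyFun {f g : V → ℂ} (hf : f ∈ polyFun V) (hg : g ∈ polyFun V) :
    (fun v => f v * g v) ∈ polyFun V := (polyFun V).mul_mem hf hg

lemma pow_mem_polyFun {f : V → ℂ} (hf : f ∈ polyFun V) (n : ℕ) :
    (fun v => f v ^ n) ∈ polyFun V := (polyFun V).pow_mem hf n

lemma sum_mem_polyFun {ι : Type*} (s : Finset ι) {f : ι → V → ℂ} (hf : ∀ i ∈ s, f i ∈ polyFun V) :
    (fun v => ∑ i ∈ s, f i v) ∈ polyFun V := by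
  have := (polyFun V).sum_mem hf
  convert this using 1
  ext v
  simp

@[elab_as_elim]
lemma polyFun_induction {p : (f : V → ℂ) → f ∈ polyFun V → Prop}
    (hl : ∀ l : Module.Dual ℂ V, p (fun v => l v) (dual_mem_polyFun l))
    (hc : ∀ c : ℂ, p (fun _ => c) (const_mem_polyFun c))
    (ha : ∀ f g hf hg, p f hf → p g hg → p (fun v => f v + g v) (add_mem_polyFun hf hg))
    (hm : ∀ f g hf hg, p f hf → p g hg → p (fun v => f v * g v) (mul_mem_polyFun hf hg))
    {f : V → ℂ} (hf : f ∈ polyFun V) : p f hf := by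
  refine Algebra.adjoin_induction (p := p) ?_ (fun c => hc c) ha hm hf
  rintro _ ⟨l, rfl⟩
  exact hl l

/-- `F` is a polynomial map between complex vector spaces. -/
def IsPolyMap (F : W → V) : Prop := ∀ l : Module.Dual ℂ V, (fun w => l (F w)) ∈ polyFun W

lemma comp_mem_polyFun {F : W → V} (hF : IsPolyMap F) {f : V → ℂ} (hf : f ∈ polyFun V) :
    (fun w => f (F w)) ∈ polyFun W := by
  induction hf using polyFun_induction with
  | hl l => exact hF l
  | hc c => exact const_mem_polyFun c
  | ha f g _ _ hf hg => exact add_mem_polyFun hf hg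
  | hm f g _ _ hf hg => exact mul_mem_polyFun hf hg

lemma IsPolyMap.comp {U : Type*} [AddCommGroup U] [Module ℂ U] {G : V → U} {F : W → V}
    (hG : IsPolyMap G) (hF : IsPolyMap F) : IsPolyMap fun w => G (F w) :=
  fun l => comp_mem_polyFun hF (hG l)

lemma LinearMap.isPolyMap (L : W →ₗ[ℂ] V) : IsPolyMap fun w => L w :=
  fun l => dual_mem_polyFun (l ∘ₗ L)

lemma isPolyMap_const (v : V) : IsPolyMap fun _ : W => v := fun _ => const_mem_polyFun _

lemma IsPolyMap.add {F G : W → V} (hF : IsPolyMap F) (hG : IsPolyMap G) :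
    IsPolyMap fun w => F w + G w := fun l => by
  simpa only [map_add] using add_mem_polyFun (hF l) (hG l)

lemma IsPolyMap.sub {F G : W → V} (hF : IsPolyMap F) (hG : IsPolyMap G) :
    IsPolyMap fun w => F w - G w := fun l => by
  simpa only [map_sub] using sub_mem_polyFun (hF l) (hG l)

lemma IsPolyMap.smul {f : W → ℂ} {F : W → V} (hf : f ∈ polyFun W) (hF : IsPolyMap F) :
    IsPolyMap fun w => f w • F w := fun l => by
  simpa only [map_smul, smul_eq_mul] using mul_mem_polyFun hf (hF l)

lemma IsPolyMap.prodMk {U : Type*} [AddCommGroup U] [Module ℂ U] {F : W → V} {G : W → U}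
    (hF : IsPolyMap F) (hG : IsPolyMap G) : IsPolyMap fun w => (F w, G w) := fun l => by
  have := add_mem_polyFun (hF (l ∘ₗ LinearMap.inl ℂ V U)) (hG (l ∘ₗ LinearMap.inr ℂ V U))
  convert this using 2 with w
  simp [← map_add]

lemma mem_polyFun.isPolyMap {f : W → ℂ} (hf : f ∈ polyFun W) : IsPolyMap f := fun l => by
  convert mul_mem_polyFun hf (const_mem_polyFun (l 1)) using 2 with w
  rw [← smul_eq_mul, ← map_smul, smul_eq_mul, mul_one]

/-- Expanding `F w` in a basis of `V` turns each scalar component into a finite sum of products. -/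
lemma IsPolyMap.bilin {U : Type*} [AddCommGroup U] [Module ℂ U] {U' : Type*} [AddCommGroup U']
    [Module ℂ U'] [FiniteDimensional ℂ V] (B : V →ₗ[ℂ] U →ₗ[ℂ] U') {F : W → V} {G : W → U}
    (hF : IsPolyMap F) (hG : IsPolyMap G) : IsPolyMap fun w => B (F w) (G w) := fun l => by
  let b := Module.finBasis ℂ V
  have : (fun w => l (B (F w) (G w))) = fun w => ∑ i, b.coord i (F w) * l (B (b i) (G w)) := by
    ext w
    conv_lhs => rw [← b.sum_repr (F w)]
    simp [-Module.Basis.sum_repr]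
  rw [this]
  exact sum_mem_polyFun _ fun i _ => mul_mem_polyFun (hF _) (hG (l ∘ₗ B (b i)))

/-- The restriction of a polynomial function to a line is a polynomial. -/
lemma exists_polynomial_of_mem_polyFun {f : V → ℂ} (hf : f ∈ polyFun V) (x y : V) :
    ∃ P : Polynomial ℂ, ∀ t : ℂ, f (x + t • y) = P.eval t := by
  induction hf using polyFun_induction with
  | hl l => exact ⟨.C (l x) + .C (l y) * .X, fun t => by simp; ring⟩
  | hc c => exact ⟨.C c, fun t => by simp⟩
  | ha f g _ _ hf hg =>
    obtain ⟨P, hP⟩ := hf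
    obtain ⟨Q, hQ⟩ := hg
    exact ⟨P + Q, fun t => by simp [hP, hQ]⟩
  | hm f g _ _ hf hg =>
    obtain ⟨P, hP⟩ := hf
    obtain ⟨Q, hQ⟩ := hg
    exact ⟨P * Q, fun t => by simp [hP, hQ]⟩

/-- The directional derivatives of a polynomial function at a point form a linear form. -/
lemma exists_differential_of_mem_polyFun {f : V → ℂ} (hf : f ∈ polyFun V) (x : V) :
    ∃ l : Module.Dual ℂ V, ∀ y, HasDerivAt (fun t : ℂ => f (x + t • y)) (l y) 0 := by
  induction hf using polyFun_induction with
  | hl l =>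
    refine ⟨l, fun y => ?_⟩
    simpa using ((hasDerivAt_id (0 : ℂ)).mul_const (l y)).const_add (l x)
  | hc c => exact ⟨0, fun y => by simpa using hasDerivAt_const (0 : ℂ) c⟩
  | ha f g _ _ hf hg =>
    obtain ⟨l, hl⟩ := hf
    obtain ⟨m, hm⟩ := hg
    exact ⟨l + m, fun y => (hl y).add (hm y)⟩
  | hm f g _ _ hf hg =>
    obtain ⟨l, hl⟩ := hf
    obtain ⟨m, hm⟩ := hg
    refine ⟨g x • l + f x • m, fun y => ?_⟩
    have := (hl y).mul (hm y)
    refine this.congr_deriv ?_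
    simp [mul_comm]

/-- Two non-zero polynomial functions have a common non-zero. -/
lemma exists_ne_zero_of_mem_polyFun {f g : V → ℂ} (hf : f ∈ polyFun V) (hg : g ∈ polyFun V)
    (hf0 : ∃ x, f x ≠ 0) (hg0 : ∃ x, g x ≠ 0) : ∃ x, f x ≠ 0 ∧ g x ≠ 0 := by
  obtain ⟨x, hx⟩ := hf0
  obtain ⟨y, hy⟩ := hg0
  -- On the line joining the two points both functions become non-zero polynomials in one variable.
  obtain ⟨P, hP⟩ := exists_polynomial_of_mem_polyFun hf x (y - x)
  obtain ⟨Q, hQ⟩ := exists_polynomial_of_mem_polyFun hg x (y - x)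
  have hP0 : P ≠ 0 := by
    rintro rfl
    exact hx (by simpa using hP 0)
  have hQ0 : Q ≠ 0 := by
    rintro rfl
    exact hy (by simpa using hQ 1)
  by_contra! h
  refine mul_ne_zero hP0 hQ0 (Polynomial.funext fun t => ?_)
  by_cases ht : P.eval t = 0
  · simp [ht]
  · simp [← hQ, h _ (by rwa [hP])]

/-- Products of polynomial functions show that the generating family is a basis, so topological
arguments reduce to single functions. -/
lemma isOpen_affineZariski_iff {U : Set V} (hU : IsOpen[affineZariski V] U) {x : V} (hx : x ∈ U) :
    ∃ f ∈ polyFun V, f x ≠ 0 ∧ ∀ y, f y ≠ 0 → y ∈ U := by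
  induction hU with
  | basic s hs =>
    obtain ⟨f, hf, rfl⟩ := hs
    exact ⟨f, hf, hx, fun y hy => hy⟩
  | univ => exact ⟨_, const_mem_polyFun 1, one_ne_zero, fun _ _ => trivial⟩
  | inter s t _ _ ihs iht =>
    obtain ⟨f, hf, hfx, hf'⟩ := ihs hx.1
    obtain ⟨g, hg, hgx, hg'⟩ := iht hx.2
    exact ⟨_, mul_mem_polyFun hf hg, mul_ne_zero hfx hgx, fun y hy =>
      ⟨hf' y (left_ne_zero_of_mul hy), hg' y (right_ne_zero_of_mul hy)⟩⟩
  | sUnion S _ ih =>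
    obtain ⟨s, hs, hxs⟩ := hx
    obtain ⟨f, hf, hfx, hf'⟩ := ih s hs hxs
    exact ⟨f, hf, hfx, fun y hy => ⟨s, hs, hf' y hy⟩⟩

lemma forGeneral_iff {P : V → Prop} :
    ForGeneral P ↔ ∃ f ∈ polyFun V, (∃ x, f x ≠ 0) ∧ ∀ x, f x ≠ 0 → P x := by
  constructor
  · rintro ⟨U, hU, ⟨x, hx⟩, h⟩
    obtain ⟨f, hf, hfx, hf'⟩ := isOpen_affineZariski_iff hU hx
    exact ⟨f, hf, ⟨x, hfx⟩, fun y hy => h y (hf' y hy)⟩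
  · rintro ⟨f, hf, ⟨x, hx⟩, h⟩
    exact ⟨{x | f x ≠ 0}, .basic _ ⟨f, hf, rfl⟩, ⟨x, hx⟩, h⟩

/-- This is the irreducibility of affine space. -/
lemma ForGeneral.and {P Q : V → Prop} (hP : ForGeneral P) (hQ : ForGeneral Q) :
    ForGeneral fun x => P x ∧ Q x := by
  rw [forGeneral_iff] at *
  obtain ⟨f, hf, hf0, hf'⟩ := hP
  obtain ⟨g, hg, hg0, hg'⟩ := hQ
  obtain ⟨x, hx⟩ := exists_ne_zero_of_mem_polyFun hf hg hf0 hg0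
  exact ⟨_, mul_mem_polyFun hf hg, ⟨x, mul_ne_zero hx.1 hx.2⟩, fun y hy =>
    ⟨hf' y (left_ne_zero_of_mul hy), hg' y (right_ne_zero_of_mul hy)⟩⟩

lemma ForGeneral.mono {P Q : V → Prop} (hP : ForGeneral P) (h : ∀ x, P x → Q x) :
    ForGeneral Q := by
  obtain ⟨U, hU, hne, hP⟩ := hP
  exact ⟨U, hU, hne, fun x hx => h x (hP x hx)⟩

lemma ForGeneral.exists {P : V → Prop} (hP : ForGeneral P) : ∃ x, P x := by
  obtain ⟨U, -, ⟨x, hx⟩, h⟩ := hP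
  exact ⟨x, h x hx⟩

lemma forGeneral_ne_zero {f : V → ℂ} (hf : f ∈ polyFun V) (h : ∃ x, f x ≠ 0) :
    ForGeneral fun x => f x ≠ 0 :=
  forGeneral_iff.2 ⟨f, hf, h, fun _ => id⟩

/-- A polynomial function that vanishes at a general point is zero. -/
lemma eq_zero_of_forGeneral {f : V → ℂ} (hf : f ∈ polyFun V) (h : ForGeneral fun x => f x = 0)
    (x : V) : f x = 0 := by
  by_contra hx
  obtain ⟨y, hy, hy'⟩ := ((forGeneral_ne_zero hf ⟨x, hx⟩).and h).exists
  exact hy hy'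

lemma eq_of_forGeneral {f g : V → ℂ} (hf : f ∈ polyFun V) (hg : g ∈ polyFun V)
    (h : ForGeneral fun x => f x = g x) : f = g :=
  funext fun x => sub_eq_zero.1 <|
    eq_zero_of_forGeneral (sub_mem_polyFun hf hg) (h.mono fun _ => sub_eq_zero.2) x

end PolynomialFunctions

/-! ### The Zariski topology of projective space. -/

section ProjectiveZariski

variable {V W : Type*} [AddCommGroup V] [Module ℂ V] [AddCommGroup W] [Module ℂ W]

lemma IsHomogeneousPoly.mul {d e : ℕ} {f g : V → ℂ} (hf : IsHomogeneousPoly d f)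
    (hg : IsHomogeneousPoly e g) : IsHomogeneousPoly (d + e) fun v => f v * g v :=
  ⟨mul_mem_polyFun hf.1 hg.1, fun c v => by
    beta_reduce
    rw [hf.2, hg.2, pow_add]
    ring⟩

lemma isHomogeneousPoly_one : IsHomogeneousPoly 0 fun _ : V => 1 :=
  ⟨const_mem_polyFun 1, by simp⟩

lemma isHomogeneousPoly_dual (l : Module.Dual ℂ V) : IsHomogeneousPoly 1 fun v => l v :=
  ⟨dual_mem_polyFun l, by simp⟩

lemma IsHomogeneousPoly.sub {d : ℕ} {f g : V → ℂ} (hf : IsHomogeneousPoly d f)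
    (hg : IsHomogeneousPoly d g) : IsHomogeneousPoly d fun v => f v - g v :=
  ⟨sub_mem_polyFun hf.1 hg.1, fun c v => by
    beta_reduce
    rw [hf.2, hg.2]
    ring⟩

lemma exists_rep_eq_smul {p : ℙ ℂ V} {v : V}
    (h : p.submodule = Submodule.span ℂ {v}) : ∃ c : ℂ, c ≠ 0 ∧ p.rep = c • v := by
  have hp := p.rep_nonzero
  have : p.rep ∈ Submodule.span ℂ {v} := by
    rw [← h, Projectivization.submodule_eq]
    exact Submodule.mem_span_singleton_self _
  obtain ⟨c, hc⟩ := Submodule.mem_span_singleton.1 this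
  refine ⟨c, ?_, hc.symm⟩
  rintro rfl
  exact hp (by simp [← hc])

lemma exists_mk_rep_eq_smul {v : V} (hv : v ≠ 0) :
    ∃ c : ℂ, c ≠ 0 ∧ (Projectivization.mk ℂ v hv).rep = c • v :=
  exists_rep_eq_smul (Projectivization.submodule_mk v hv)

lemma IsHomogeneousPoly.smul_eq_zero_iff {d : ℕ} {f : V → ℂ} (hf : IsHomogeneousPoly d f) {c : ℂ}
    (hc : c ≠ 0) (v : V) : f (c • v) = 0 ↔ f v = 0 := by
  simp [hf.2, hc]

lemma IsHomogeneousPoly.mk_rep_eq_zero_iff {d : ℕ} {f : V → ℂ} (hf : IsHomogeneousPoly d f)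
    {v : V} (hv : v ≠ 0) : f (Projectivization.mk ℂ v hv).rep = 0 ↔ f v = 0 := by
  obtain ⟨c, hc, h⟩ := exists_mk_rep_eq_smul hv
  rw [h, hf.smul_eq_zero_iff hc]

lemma isOpen_homogeneous_ne_zero {d : ℕ} {f : V → ℂ} (hf : IsHomogeneousPoly d f) :
    IsOpen[projZariski V] {p | f p.rep ≠ 0} :=
  .basic _ ⟨d, f, hf, rfl⟩

lemma isClosed_homogeneous_eq_zero {d : ℕ} {f : V → ℂ} (hf : IsHomogeneousPoly d f) :
    IsClosed[projZariski V] {p | f p.rep = 0} :=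
  (@isOpen_compl_iff _ _ (projZariski V)).1 (isOpen_homogeneous_ne_zero hf)

lemma isOpen_projZariski_iff {U : Set (ℙ ℂ V)} (hU : IsOpen[projZariski V] U) {p : ℙ ℂ V}
    (hp : p ∈ U) : ∃ (d : ℕ) (f : V → ℂ), IsHomogeneousPoly d f ∧ f p.rep ≠ 0 ∧
      ∀ q : ℙ ℂ V, f q.rep ≠ 0 → q ∈ U := by
  induction hU with
  | basic s hs =>
    obtain ⟨d, f, hf, rfl⟩ := hs
    exact ⟨d, f, hf, hp, fun y hy => hy⟩
  | univ => exact ⟨0, _, isHomogeneousPoly_one, one_ne_zero, fun _ _ => trivial⟩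
  | inter s t _ _ ihs iht =>
    obtain ⟨d, f, hf, hfx, hf'⟩ := ihs hp.1
    obtain ⟨e, g, hg, hgx, hg'⟩ := iht hp.2
    exact ⟨_, _, hf.mul hg, mul_ne_zero hfx hgx, fun y hy =>
      ⟨hf' y (left_ne_zero_of_mul hy), hg' y (right_ne_zero_of_mul hy)⟩⟩
  | sUnion S _ ih =>
    obtain ⟨s, hs, hxs⟩ := hp
    obtain ⟨d, f, hf, hfx, hf'⟩ := ih s hs hxs
    exact ⟨d, f, hf, hfx, fun y hy => ⟨s, hs, hf' y hy⟩⟩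

/-- The non-vanishing sets of homogeneous functions form a basis, so membership in a closure can be
tested on one equation at a time. -/
lemma mem_closure_projZariski_iff {S : Set (ℙ ℂ V)} {p : ℙ ℂ V} :
    p ∈ closure[projZariski V] S ↔ ∀ (d : ℕ) (f : V → ℂ), IsHomogeneousPoly d f →
      (∀ q ∈ S, f q.rep = 0) → f p.rep = 0 := by
  let := projZariski V
  rw [mem_closure_iff]
  constructor
  · intro h d f hf hS
    by_contra hp
    obtain ⟨q, hq, hqS⟩ := h _ (isOpen_homogeneous_ne_zero hf) hp
    exact hq (hS q hqS)
  · intro h U hU hp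
    obtain ⟨d, f, hf, hfp, hfU⟩ := isOpen_projZariski_iff hU hp
    by_contra hne
    refine hfp (h d f hf fun q hq => ?_)
    by_contra hfq
    exact hne ⟨q, hfU q hfq, hq⟩

/-- A nowhere vanishing polynomial map induces a continuous map to the projective space. -/
lemma continuous_mk_of_isPolyMap {F : W → V} (hF : IsPolyMap F) (h0 : ∀ w, F w ≠ 0) :
    @Continuous _ _ (affineZariski W) (projZariski V) fun w => Projectivization.mk ℂ (F w) (h0 w) := by
  refine continuous_generateFrom_iff.2 ?_
  rintro _ ⟨d, f, hf, rfl⟩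
  refine .basic _ ⟨_, comp_mem_polyFun hF hf.1, ?_⟩
  ext w
  simp [hf.mk_rep_eq_zero_iff]

lemma isIrreducible_submodule (S : Submodule ℂ W) :
    @IsIrreducible _ (affineZariski W) (S : Set W) := by
  let := affineZariski W
  refine ⟨⟨0, S.zero_mem⟩, ?_⟩
  rintro U U' hU hU' ⟨x, hxS, hx⟩ ⟨y, hyS, hy⟩
  obtain ⟨f, hf, hfx, hfU⟩ := isOpen_affineZariski_iff hU hx
  obtain ⟨g, hg, hgy, hgU⟩ := isOpen_affineZariski_iff hU' hy
  obtain ⟨z, hz⟩ := exists_ne_zero_of_mem_polyFun (comp_mem_polyFun S.subtype.isPolyMap hf)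
    (comp_mem_polyFun S.subtype.isPolyMap hg) ⟨⟨x, hxS⟩, hfx⟩ ⟨⟨y, hyS⟩, hgy⟩
  exact ⟨z, z.2, hfU _ hz.1, hgU _ hz.2⟩

end ProjectiveZariski

/-! ### The minimal polynomial of an element with three-dimensional `ℂ[x]`. -/

section GenericMinimalPolynomial

variable {J : Type*} [NonAssocCommRing J] [Module ℂ J]

lemma jordanPow_mem_powerSpan (x : J) (k : ℕ) : jordanPow x k ∈ powerSpan x :=
  Submodule.subset_span ⟨k, rfl⟩

/-- The unit as an element of `ℂ[x]`. -/
def powerSpanOne (x : J) : powerSpan x := ⟨jordanPow x 0, jordanPow_mem_powerSpan x 0⟩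

variable [SMulCommClass ℂ J J]

lemma mulRestrict_pow_apply_one (x : J) (k : ℕ) :
    ((mulRestrict x ^ k) (powerSpanOne x) : J) = jordanPow x k := by
  induction k with
  | zero => rfl
  | succ k ih =>
    rw [pow_succ', Module.End.mul_apply]
    exact congrArg (x * ·) ih

/-- If `ℂ[x]` has dimension three, then it is spanned by the independent elements `e, x, x ^ 2`. -/
lemma powerSpan_of_finrank_eq_three {x : J} (hx : Module.finrank ℂ (powerSpan x) = 3) :
    LinearIndependent ℂ ![1, x, x * x] ∧
      ∃ a : Fin 3 → ℂ, x * (x * x) = a 2 • (x * x) + a 1 • x + a 0 • (1 : J) := by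
  have : Module.Finite ℂ (powerSpan x) := Module.finite_of_finrank_pos (by omega)
  have hrel : ∃ a : Fin 3 → ℂ, x * (x * x) = a 2 • (x * x) + a 1 • x + a 0 • (1 : J) := by
    -- Cayley–Hamilton on `ℂ[x]`, applied to the unit.
    have h := LinearMap.aeval_self_charpoly (mulRestrict x)
    rw [Polynomial.aeval_eq_sum_range, LinearMap.charpoly_natDegree, hx] at h
    have hm := (mulRestrict x).charpoly_monic
    rw [Polynomial.Monic, Polynomial.leadingCoeff, LinearMap.charpoly_natDegree, hx] at hm
    have h1 := congrArg Subtype.val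
      (LinearMap.congr_fun h (powerSpanOne x))
    simp only [Finset.sum_range_succ, hm, Finset.range_zero, Finset.sum_empty, one_smul, zero_add,
      LinearMap.add_apply, LinearMap.smul_apply, Submodule.coe_add, Submodule.coe_smul,
      mulRestrict_pow_apply_one, jordanPow, mul_one, LinearMap.zero_apply,
      ZeroMemClass.coe_zero] at h1
    refine ⟨fun i => -(mulRestrict x).charpoly.coeff i, ?_⟩
    simp only [neg_smul]
    rw [← sub_eq_zero, ← h1]
    simp only [Fin.coe_ofNat_eq_mod, Nat.reduceMod]
    abel
  refine ⟨?_, hrel⟩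
  obtain ⟨a, ha⟩ := hrel
  -- By the relation this span is stable under multiplication by `x`, hence is all of `ℂ[x]`; three
  -- vectors spanning a space of dimension three are independent.
  set S := Submodule.span ℂ (Set.range ![1, x, x * x]) with hS
  have h0 : (1 : J) ∈ S := Submodule.subset_span ⟨0, rfl⟩
  have h1 : x ∈ S := Submodule.subset_span ⟨1, rfl⟩
  have h2 : x * x ∈ S := Submodule.subset_span ⟨2, rfl⟩
  have hmul : ∀ y ∈ S, LinearMap.mulLeft ℂ x y ∈ S := by
    intro y hy
    have : S ≤ S.comap (LinearMap.mulLeft ℂ x) := by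
      rw [hS, Submodule.span_le, ← hS]
      rintro _ ⟨i, rfl⟩
      fin_cases i
      · simpa using h1
      · simpa using h2
      · change x * (x * x) ∈ S
        rw [ha]
        exact S.add_mem (S.add_mem (S.smul_mem _ h2) (S.smul_mem _ h1)) (S.smul_mem _ h0)
    exact this hy
  have hpow : ∀ k, jordanPow x k ∈ S := by
    intro k
    induction k with
    | zero => exact h0
    | succ k ih => exact hmul _ ih
  have hle : powerSpan x = S := by
    apply le_antisymm
    · rw [powerSpan, Submodule.span_le]
      rintro _ ⟨k, rfl⟩
      exact hpow k
    · rw [hS, Submodule.span_le]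
      rintro _ ⟨i, rfl⟩
      fin_cases i
      · exact jordanPow_mem_powerSpan x 0
      · simpa [jordanPow] using jordanPow_mem_powerSpan x 1
      · simpa [jordanPow] using jordanPow_mem_powerSpan x 2
  rw [linearIndependent_iff_card_eq_finrank_span, Set.finrank, ← hS, ← hle, hx]
  rfl

lemma polynomial_eq_of_natDegree_le_two {R : Type*} [CommRing R] {p : Polynomial R}
    (hp : p.natDegree < 3) :
    p = .C (p.coeff 2) * .X ^ 2 + .C (p.coeff 1) * .X + .C (p.coeff 0) := by
  conv_lhs => rw [p.as_sum_range' 3 hp]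
  simp only [Finset.sum_range_succ, Finset.range_zero, Finset.sum_empty,
    ← Polynomial.C_mul_X_pow_eq_monomial]
  simp
  ring

/-- The monic cubic polynomial with prescribed lower coefficients. -/
def monicCubic {R : Type*} [CommRing R] (a : Fin 3 → R) : Polynomial R :=
  .X ^ 3 - (.C (a 2) * .X ^ 2 + .C (a 1) * .X + .C (a 0))

lemma degree_monicCubic_aux {R : Type*} [CommRing R] (a : Fin 3 → R) :
    (.C (a 2) * .X ^ 2 + .C (a 1) * .X + .C (a 0) : Polynomial R).degree < 3 :=
  lt_of_le_of_lt Polynomial.degree_quadratic_le (by norm_num)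

lemma monicCubic_monic {R : Type*} [CommRing R] (a : Fin 3 → R) : (monicCubic a).Monic :=
  Polynomial.monic_X_pow_sub (n := 3) (degree_monicCubic_aux a)

lemma natDegree_monicCubic {R : Type*} [CommRing R] [Nontrivial R] (a : Fin 3 → R) :
    (monicCubic a).natDegree = 3 := by
  rw [monicCubic, Polynomial.natDegree_sub_eq_left_of_natDegree_lt]
  · simp
  · rw [Polynomial.natDegree_X_pow]
    exact (Polynomial.natDegree_quadratic_le).trans_lt (by norm_num)

lemma coeff_monicCubic {R : Type*} [CommRing R] (a : Fin 3 → R) (i : Fin 3) :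
    (monicCubic a).coeff i = -a i := by
  fin_cases i <;> simp [monicCubic, Polynomial.coeff_X, Polynomial.coeff_C]

/-- The minimal polynomial of the multiplication by `x` on `ℂ[x]` is read off from the expression
of `x ^ 3` by the independent elements `e, x, x ^ 2`. -/
lemma minpoly_mulRestrict {x : J} (hli : LinearIndependent ℂ ![1, x, x * x]) {a : Fin 3 → ℂ}
    (ha : x * (x * x) = a 2 • (x * x) + a 1 • x + a 0 • (1 : J)) :
    minpoly ℂ (mulRestrict x) = monicCubic a := by
  set T := mulRestrict x with hT
  set e := powerSpanOne x
  have he : (e : J) = 1 := rfl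
  have hk : ∀ k, ((T ^ k) e : J) = jordanPow x k := mulRestrict_pow_apply_one x
  symm
  refine minpoly.unique' ℂ T (monicCubic_monic a) ?_ ?_
  · set q := Polynomial.aeval T (monicCubic a) with hq
    have hqe : q e = 0 := by
      apply Subtype.ext
      have h1 : (T e : J) = jordanPow x 1 := by simpa using hk 1
      simp [hq, monicCubic, hk, jordanPow, ha, h1, he]
    -- `q` commutes with `T`, so killing the unit it kills all powers of `x`.
    have hqT : ∀ k, q ((T ^ k) e) = 0 := by
      intro k
      have : Commute q (T ^ k) := by
        rw [hq]
        simpa using (Commute.all (monicCubic a) (.X ^ k)).map (Polynomial.aeval T)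
      rw [← Module.End.mul_apply, this.eq, Module.End.mul_apply, hqe, map_zero]
    ext ⟨y, hy⟩
    refine Submodule.span_induction
      (p := fun y hy => ((q ⟨y, hy⟩ : powerSpan x) : J) = 0) ?_ ?_ ?_ ?_ hy
    · rintro _ ⟨k, rfl⟩
      have := hqT k
      rw [show (T ^ k) e = ⟨jordanPow x k, jordanPow_mem_powerSpan x k⟩ from
        Subtype.ext (hk k)] at this
      exact congrArg Subtype.val this
    · exact congrArg Subtype.val (map_zero q)
    · intro y z hy hz h1 h2
      have := congrArg Subtype.val (map_add q ⟨y, hy⟩ ⟨z, hz⟩)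
      exact this.trans (by simp [h1, h2])
    · intro c y hy h1
      have := congrArg Subtype.val (map_smul q c ⟨y, hy⟩)
      exact this.trans (by simp [h1])
  -- If `r` has degree below three and annihilates `T`, evaluation at the unit gives a linear
  -- relation between `e, x, x ^ 2`.
  · intro r hr
    rw [or_iff_not_imp_right, not_not]
    intro hr0
    have hdeg : r.natDegree < 3 := by
      by_cases h : r = 0
      · simp [h]
      · have := Polynomial.natDegree_lt_natDegree h hr
        rwa [natDegree_monicCubic] at this
    rw [polynomial_eq_of_natDegree_le_two hdeg] at hr0 ⊢
    have h1 : (T e : J) = jordanPow x 1 := by simpa using hk 1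
    have := congrArg Subtype.val (LinearMap.congr_fun hr0 e)
    simp [hk, h1, jordanPow, he] at this
    have h0 := Fintype.linearIndependent_iff.1 hli ![r.coeff 0, r.coeff 1, r.coeff 2]
      (by rw [← this]; simp [Fin.sum_univ_three]; abel)
    have h00 := h0 0
    have h01 := h0 1
    have h02 := h0 2
    simp at h00 h01 h02
    simp [h00, h01, h02]

variable (J) in
lemma forGeneral_linearIndependent (hJ : HasJordanRank J 3) :
    ForGeneral fun x : J => LinearIndependent ℂ ![1, x, x * x] :=
  ForGeneral.mono hJ fun _ hx => (powerSpan_of_finrank_eq_three hx).1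

end GenericMinimalPolynomial

/-! ### Multiplication by the generic element, with polynomial entries. -/

section GenericElement

variable {J : Type*} [NonAssocCommRing J] [Module ℂ J]
  {ι : Type*} (b : Module.Basis ι ℂ J)

lemma eval_repr_mem_polyFun (P : MvPolynomial ι ℂ) :
    (fun x => MvPolynomial.eval (b.repr x) P) ∈ polyFun J := by
  induction P using MvPolynomial.induction_on with
  | C a => simpa using const_mem_polyFun a
  | add p q hp hq => simpa using add_mem_polyFun hp hq
  | mul_X p i hp => simpa using mul_mem_polyFun hp (dual_mem_polyFun (b.coord i))

variable [Fintype ι]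

lemma eq_of_eval_repr {P Q : MvPolynomial ι ℂ}
    (h : ForGeneral fun x => MvPolynomial.eval (b.repr x) P = MvPolynomial.eval (b.repr x) Q) :
    P = Q := by
  refine MvPolynomial.funext fun y => ?_
  have := congrFun (eq_of_forGeneral (eval_repr_mem_polyFun b P) (eval_repr_mem_polyFun b Q) h)
    (b.equivFun.symm y)
  have hy : (b.repr (b.equivFun.symm y) : ι → ℂ) = y := b.equivFun.apply_symm_apply y
  beta_reduce at this
  rwa [hy] at this

/-- The matrix of the multiplication by the generic element. -/
def genericMulMatrix : Matrix ι ι (MvPolynomial ι ℂ) :=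
  .of fun j k => ∑ i, .X i * .C (b.repr (b i * b k) j)

/-- The coordinates of the powers of the generic element. -/
def genericPow : ℕ → ι → MvPolynomial ι ℂ
  | 0 => fun j => .C (b.repr 1 j)
  | n + 1 => (genericMulMatrix b).mulVec (genericPow n)

lemma genericPow_eq_pow_mulVec [DecidableEq ι] (n : ℕ) :
    genericPow b n = (genericMulMatrix b ^ n).mulVec (genericPow b 0) := by
  induction n with
  | zero => simp
  | succ n ih => rw [pow_succ', ← Matrix.mulVec_mulVec, ← ih, genericPow]

variable [SMulCommClass ℂ J J] [IsScalarTower ℂ J J]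

lemma eval_genericPow (x : J) (n : ℕ) (j : ι) :
    MvPolynomial.eval (b.repr x) (genericPow b n j) = b.repr (jordanPow x n) j := by
  induction n generalizing j with
  | zero => simp [genericPow, jordanPow]
  | succ n ih =>
    have hmul (y z : J) : y * z = (∑ i, b.repr y i • b i) * ∑ i, b.repr z i • b i := by
      rw [b.sum_repr, b.sum_repr]
    rw [jordanPow, hmul]
    simp only [genericPow, genericMulMatrix, Matrix.mulVec, dotProduct, Matrix.of_apply, map_sum,
      map_mul, ih, MvPolynomial.eval_X, MvPolynomial.eval_C, Finset.sum_mul_sum, smul_mul_smul_comm,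
      map_smul, Finsupp.coe_finsetSum, Finset.sum_apply, Finsupp.smul_apply, smul_eq_mul]
    rw [Finset.sum_comm]
    simp only [Finset.sum_mul]
    refine Finset.sum_congr rfl fun i _ => Finset.sum_congr rfl fun k _ => ?_
    ring

end GenericElement


/-! ### Polynomiality of the generic minimum polynomial. -/

section GenericCoefficients

variable {J : Type*} [NonAssocCommRing J] [Module ℂ J] [SMulCommClass ℂ J J]

/-- Two candidates agree at a general point, hence everywhere, so exhibiting one identifies the
chosen function. -/
lemma genericCoeff_spec (i : ℕ) {σ : J → ℂ} (hσ : σ ∈ polyFun J)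
    (h : ForGeneral fun x : J => i ≤ (minpoly ℂ (mulRestrict x)).natDegree ∧
      σ x = (-1) ^ i *
        (minpoly ℂ (mulRestrict x)).coeff ((minpoly ℂ (mulRestrict x)).natDegree - i)) :
    genericCoeff (J := J) i = σ := by
  have := Classical.epsilon_spec (p := fun σ : J → ℂ => σ ∈ polyFun J ∧
    ForGeneral fun x : J => i ≤ (minpoly ℂ (mulRestrict x)).natDegree ∧
      σ x = (-1) ^ i *
        (minpoly ℂ (mulRestrict x)).coeff ((minpoly ℂ (mulRestrict x)).natDegree - i))
    ⟨σ, hσ, h⟩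
  exact eq_of_forGeneral this.1 hσ ((this.2.and h).mono fun x hx => hx.1.2.trans hx.2.2.symm)

variable [IsScalarTower ℂ J J] [FiniteDimensional ℂ J]

lemma mulVec_aeval_mul_eq_zero {ι K : Type*} [Fintype ι] [DecidableEq ι] [Field K]
    (M : Matrix ι ι K) (v : ι → K) {q h : Polynomial K}
    (hq : (Polynomial.aeval M q).mulVec v = 0) : (Polynomial.aeval M (q * h)).mulVec v = 0 := by
  rw [mul_comm, map_mul, ← Matrix.mulVec_mulVec, hq, Matrix.mulVec_zero]

/-- If `v, M v, M ^ 2 v` are independent (as witnessed by `B`) and `M ^ 3 v` depends on them, then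
the relation is a divisor of the characteristic polynomial of `M`. -/
lemma monicCubic_dvd_charpoly {ι K : Type*} [Fintype ι] [DecidableEq ι] [Field K]
    (M : Matrix ι ι K) (v : ι → K) (B : Matrix (Fin 3) ι K)
    (hB : (Matrix.of fun i j : Fin 3 => B.mulVec ((M ^ (j : ℕ)).mulVec v) i).det ≠ 0)
    (a : Fin 3 → K) (ha : (M ^ 3).mulVec v = ∑ j, a j • (M ^ (j : ℕ)).mulVec v) :
    monicCubic a ∣ M.charpoly := by
  have hexp (p : Polynomial K) : ∀ r : Fin 3 → K,
      p = .C (r 2) * .X ^ 2 + .C (r 1) * .X + .C (r 0) →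
      (Polynomial.aeval M p).mulVec v = ∑ j, r j • (M ^ (j : ℕ)).mulVec v := by
    rintro r rfl
    simp [Fin.sum_univ_three, Matrix.add_mulVec, Algebra.algebraMap_eq_smul_one,
      Matrix.smul_mulVec]
    abel
  have hq : (Polynomial.aeval M (monicCubic a)).mulVec v = 0 := by
    rw [monicCubic, map_sub, Matrix.sub_mulVec, hexp _ a rfl, ← ha]
    simp
  rw [← Polynomial.modByMonic_eq_zero_iff_dvd (monicCubic_monic a)]
  -- The remainder kills `v`, because the characteristic polynomial and the cubic both do. Its
  -- degree is below three, so independence of `v, M v, M ^ 2 v` makes it zero.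
  set r := M.charpoly %ₘ monicCubic a with hr
  have hdeg : r.natDegree < 3 := by
    have := Polynomial.natDegree_modByMonic_lt M.charpoly (monicCubic_monic a) (by
      intro h
      have := natDegree_monicCubic a
      simp [h] at this)
    rwa [natDegree_monicCubic] at this
  have hr0 : (Polynomial.aeval M r).mulVec v = 0 := by
    have h := congrArg (fun p => (Polynomial.aeval M p).mulVec v)
      (Polynomial.modByMonic_add_div M.charpoly (monicCubic a))
    simpa [Matrix.add_mulVec, Matrix.aeval_self_charpoly, ← map_mul, -map_mul,
      mulVec_aeval_mul_eq_zero M v hq] using h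
  have hrep := polynomial_eq_of_natDegree_le_two hdeg
  rw [hexp r (fun j => r.coeff j) hrep] at hr0
  have hz : (Matrix.of fun i j : Fin 3 => B.mulVec ((M ^ (j : ℕ)).mulVec v) i).mulVec
      (fun j => r.coeff j) = 0 := by
    have := congrArg B.mulVec hr0
    rw [Matrix.mulVec_zero, Matrix.mulVec_sum] at this
    ext i
    have h := congrFun this i
    simp only [Finset.sum_apply, Matrix.mulVec_smul, Pi.smul_apply, smul_eq_mul] at h
    rw [← h]
    simp only [Matrix.mulVec, dotProduct, Matrix.of_apply]
    exact Finset.sum_congr rfl fun j _ => mul_comm _ _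
  have h0 := Matrix.eq_zero_of_mulVec_eq_zero hB hz
  have h00 := congrFun h0 0
  have h01 := congrFun h0 1
  have h02 := congrFun h0 2
  simp at h00 h01 h02
  rw [hrep]
  simp [h00, h01, h02]

/-- Over an integrally closed domain, if `v, M v, M ^ 2 v` are independent (as witnessed by `B`) and
a multiple of `M ^ 3 v` depends on them, then so does `M ^ 3 v`. -/
lemma exists_relation_of_isIntegrallyClosed {ι A : Type*} [Fintype ι] [DecidableEq ι] [CommRing A]
    [IsDomain A] [IsIntegrallyClosed A] (M : Matrix ι ι A) (v : ι → A) (B : Matrix (Fin 3) ι A)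
    {D : A} (hD : D ≠ 0)
    (hB : (Matrix.of fun i j : Fin 3 => B.mulVec ((M ^ (j : ℕ)).mulVec v) i).det = D)
    (c : Fin 3 → A) (hc : D • (M ^ 3).mulVec v = ∑ j, c j • (M ^ (j : ℕ)).mulVec v) :
    ∃ a : Fin 3 → A, (M ^ 3).mulVec v = ∑ j, a j • (M ^ (j : ℕ)).mulVec v := by
  let K := FractionRing A
  set φ := algebraMap A K
  have hinj : Function.Injective φ := IsFractionRing.injective A K
  have hDK : φ D ≠ 0 := by simpa using (map_ne_zero_iff _ hinj).2 hD
  have hpow (n : ℕ) : (M.map φ ^ n).mulVec (φ ∘ v) = φ ∘ (M ^ n).mulVec v := by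
    have h1 : M.map φ ^ n = (M ^ n).map φ := by
      simpa using (φ.mapMatrix.map_pow M n).symm
    ext i
    rw [h1, Function.comp_apply, RingHom.map_mulVec]
  have hdvd : monicCubic (fun j => φ (c j) / φ D) ∣ M.charpoly.map φ := by
    rw [← Matrix.charpoly_map]
    refine monicCubic_dvd_charpoly (M.map φ) (φ ∘ v) (B.map φ) ?_ _ ?_
    · have : (Matrix.of fun i j : Fin 3 =>
          (B.map φ).mulVec ((M.map φ ^ (j : ℕ)).mulVec (φ ∘ v)) i) =
          (Matrix.of fun i j : Fin 3 => B.mulVec ((M ^ (j : ℕ)).mulVec v) i).map φ := by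
        ext i j
        rw [Matrix.of_apply, hpow, Matrix.map_apply, Matrix.of_apply, RingHom.map_mulVec]
      rw [this, ← RingHom.mapMatrix_apply, ← RingHom.map_det, hB]
      exact hDK
    · ext k
      have := congrArg φ (congrFun hc k)
      simp only [Pi.smul_apply, Finset.sum_apply, smul_eq_mul, map_mul, map_sum] at this
      simp only [hpow, Finset.sum_apply, Pi.smul_apply, Function.comp_apply, smul_eq_mul]
      apply mul_left_cancel₀ hDK
      rw [this, Finset.mul_sum]
      refine Finset.sum_congr rfl fun j _ => ?_
      rw [← mul_assoc, mul_div_cancel₀ _ hDK]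
  -- Gauss's lemma: a monic factor, over the fraction field, of a monic polynomial over `A` has its
  -- coefficients in `A`.
  obtain ⟨g, hg⟩ := IsIntegrallyClosed.eq_map_mul_C_of_dvd K M.charpoly_monic hdvd
  rw [(monicCubic_monic _).leadingCoeff, Polynomial.C_1, mul_one] at hg
  have hs (j : Fin 3) : c j = D * -g.coeff j := by
    apply hinj
    have := coeff_monicCubic (fun j => φ (c j) / φ D) j
    rw [← hg, Polynomial.coeff_map] at this
    change φ (g.coeff j) = _ at this
    rw [map_mul, map_neg, this, neg_neg, mul_div_cancel₀ _ hDK]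
  refine ⟨fun j => -g.coeff j, ?_⟩
  ext k
  have := congrFun hc k
  simp only [Pi.smul_apply, Finset.sum_apply, smul_eq_mul, hs, mul_assoc, ← Finset.mul_sum] at this
  simpa using mul_left_cancel₀ hD this

variable (J) in
/-- The coefficients of the generic minimum polynomial are polynomial functions. -/
theorem exists_generic_relation (hJ : HasJordanRank J 3) :
    ∃ a : Fin 3 → J → ℂ, (∀ i, a i ∈ polyFun J) ∧
      ∀ x : J, x * (x * x) = a 2 x • (x * x) + a 1 x • x + a 0 x • (1 : J) := by
  classical
  set b := Module.finBasis ℂ J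
  have hgen : ForGeneral fun x : J => LinearIndependent ℂ ![1, x, x * x] ∧
      ∃ a : Fin 3 → ℂ, x * (x * x) = a 2 • (x * x) + a 1 • x + a 0 • (1 : J) :=
    ForGeneral.mono hJ fun _ hx => powerSpan_of_finrank_eq_three hx
  obtain ⟨x₀, hx₀, -⟩ := hgen.exists
  -- `β` reads off coordinates with respect to `e, x₀, x₀ ^ 2`. Applied to the powers of the generic
  -- element it gives `G`, which specializes to the identity at `x₀`; so `det G` is not the zero
  -- polynomial.
  obtain ⟨β, hβ⟩ := LinearMap.exists_leftInverse_of_injective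
    (Fintype.linearCombination ℂ ![1, x₀, x₀ * x₀])
    (LinearMap.ker_eq_bot.2 (linearIndependent_iff_injective_fintypeLinearCombination.1 hx₀))
  set B : Matrix (Fin 3) (Fin (Module.finrank ℂ J)) (MvPolynomial _ ℂ) :=
    .of fun i k => .C (β (b k) i) with hBdef
  set G : Matrix (Fin 3) (Fin 3) (MvPolynomial (Fin (Module.finrank ℂ J)) ℂ) :=
    .of fun i j => B.mulVec (genericPow b j) i with hG
  have hBv (x : J) (n : ℕ) (i : Fin 3) :
      MvPolynomial.eval (b.repr x) (B.mulVec (genericPow b n) i) = β (jordanPow x n) i := by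
    conv_rhs => rw [← b.sum_repr (jordanPow x n)]
    simp only [hBdef, Matrix.mulVec, dotProduct, Matrix.of_apply, map_sum, map_mul,
      MvPolynomial.eval_C, eval_genericPow, map_smul, Finset.sum_apply, Pi.smul_apply, smul_eq_mul]
    exact Finset.sum_congr rfl fun _ _ => mul_comm _ _
  have hD : G.det ≠ 0 := by
    intro h
    have h1 : MvPolynomial.eval (b.repr x₀) G.det = 0 := by rw [h, map_zero]
    have h2 : G.map (MvPolynomial.eval (b.repr x₀)) = 1 := by
      ext i j
      rw [Matrix.map_apply, hG, Matrix.of_apply, hBv]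
      have := congrFun (LinearMap.congr_fun hβ (Pi.single j 1)) i
      rw [LinearMap.comp_apply, Fintype.linearCombination_apply_single] at this
      rw [Matrix.one_apply]
      fin_cases j <;> simpa [jordanPow, Pi.single_apply] using this
    rw [RingHom.map_det, RingHom.mapMatrix_apply, h2, Matrix.det_one] at h1
    exact one_ne_zero h1
  -- Cramer's rule: at a general point `c` is `det G` times the coefficients of the relation.
  set c := G.adjugate.mulVec (B.mulVec (genericPow b 3)) with hcdef
  have hrel : G.det • genericPow b 3 = ∑ j : Fin 3, c j • genericPow b j := by
    ext1 k
    refine eq_of_eval_repr b (hgen.mono fun x hx => ?_)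
    obtain ⟨-, a, ha⟩ := hx
    have ha' : jordanPow x 3 = ∑ j : Fin 3, a j • jordanPow x j := by
      simp [jordanPow, ha, Fin.sum_univ_three]
      abel
    set ev := MvPolynomial.eval (b.repr x) with hev
    have hB3 : ev ∘ (B.mulVec (genericPow b 3)) = (G.map ev).mulVec a := by
      ext i
      rw [Function.comp_apply, hBv, ha', map_sum]
      simp only [map_smul, Finset.sum_apply, Pi.smul_apply, smul_eq_mul, Matrix.mulVec, dotProduct,
        Matrix.map_apply, hG, Matrix.of_apply]
      refine Finset.sum_congr rfl fun j _ => ?_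
      rw [mul_comm]
      exact congrArg (· * a j) (hBv x j i).symm
    have hcj (j : Fin 3) : ev (c j) = ev G.det * a j := by
      rw [hcdef, RingHom.map_mulVec, hB3, ← RingHom.mapMatrix_apply, ← RingHom.mapMatrix_apply,
        RingHom.map_adjugate, Matrix.mulVec_mulVec, Matrix.adjugate_mul, ← RingHom.map_det,
        Matrix.smul_mulVec, Matrix.one_mulVec, Pi.smul_apply, smul_eq_mul]
    simp only [Pi.smul_apply, Finset.sum_apply, smul_eq_mul, map_mul, map_sum, hcj]
    simp only [hev, eval_genericPow, ha', map_sum, map_smul, Finsupp.coe_finsetSum,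
      Finset.sum_apply, Finsupp.smul_apply, smul_eq_mul, Finset.mul_sum, mul_assoc]
  obtain ⟨a, ha⟩ := exists_relation_of_isIntegrallyClosed (genericMulMatrix b) (genericPow b 0) B hD
    (by simp only [← genericPow_eq_pow_mulVec]; rfl) c
    (by simpa only [← genericPow_eq_pow_mulVec] using hrel)
  refine ⟨fun j x => MvPolynomial.eval (b.repr x) (a j), fun j => eval_repr_mem_polyFun b _,
    fun x => b.repr.injective ?_⟩
  ext k
  simp only [← genericPow_eq_pow_mulVec] at ha
  have := congrArg (MvPolynomial.eval (b.repr x)) (congrFun ha k)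
  simp only [Finset.sum_apply, Pi.smul_apply, smul_eq_mul, map_sum, map_mul, eval_genericPow] at this
  simp only [Fin.sum_univ_three, jordanPow, mul_one] at this
  simp only [map_add, map_smul, Finsupp.add_apply, Finsupp.smul_apply, smul_eq_mul]
  rw [this]
  ring

variable (J) in
/-- The generic minimum polynomial in rank three: its coefficients are polynomial functions, and
it annihilates every element. -/
theorem genericCoeff_polynomial_and_relation (hJ : HasJordanRank J 3) :
    (∀ i ∈ Finset.Icc 1 3, genericCoeff (J := J) i ∈ polyFun J) ∧
      ∀ x : J, x * (x * x) =
        genericCoeff 1 x • (x * x) - genericCoeff 2 x • x + genericCoeff 3 x • (1 : J) := by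
  obtain ⟨a, ha, hrel⟩ := exists_generic_relation J hJ
  have hmin : ForGeneral fun x : J => minpoly ℂ (mulRestrict x) = monicCubic fun i => a i x :=
    (forGeneral_linearIndependent J hJ).mono fun x hx => minpoly_mulRestrict hx (hrel x)
  have h1 : genericCoeff (J := J) 1 = a 2 := by
    refine genericCoeff_spec 1 (ha 2) (hmin.mono fun x hx => ?_)
    rw [hx, natDegree_monicCubic, show 3 - 1 = ((2 : Fin 3) : ℕ) from rfl, coeff_monicCubic]
    simp
  have h2 : genericCoeff (J := J) 2 = fun x => -a 1 x := by
    refine genericCoeff_spec 2 ((polyFun J).neg_mem (ha 1)) (hmin.mono fun x hx => ?_)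
    rw [hx, natDegree_monicCubic, show 3 - 2 = ((1 : Fin 3) : ℕ) from rfl, coeff_monicCubic]
    simp
  have h3 : genericCoeff (J := J) 3 = a 0 := by
    refine genericCoeff_spec 3 (ha 0) (hmin.mono fun x hx => ?_)
    rw [hx, natDegree_monicCubic, show 3 - 3 = ((0 : Fin 3) : ℕ) from rfl, coeff_monicCubic]
    norm_num
  refine ⟨fun i hi => ?_, fun x => ?_⟩
  · rw [Finset.mem_Icc] at hi
    obtain ⟨hi1, hi3⟩ := hi
    interval_cases i
    · exact h1 ▸ ha 2
    · exact h2 ▸ (polyFun J).neg_mem (ha 1)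
    · exact h3 ▸ ha 0
  · rw [h1, h2, h3, hrel]
    simp

end GenericCoefficients

/-! ### Commutators of multiplications are derivations. -/

section JordanDerivation

variable {J : Type*} [NonAssocCommRing J] [Module ℂ J] [IsCommJordan J]

/-- The linearized Jordan identity. -/
lemma jordan_linearized (a b c d : J) :
    a * ((b * c) * d) - (b * c) * (a * d) + (b * ((c * a) * d) - (c * a) * (b * d)) +
      (c * ((a * b) * d) - (a * b) * (c * d)) = 0 := by
  have h := DFunLike.congr_fun (two_nsmul_lie_lmul_lmul_add_add_eq_zero a b c) d
  simp only [LieRing.of_associative_ring_bracket] at h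
  change (2 : ℕ) • (a * ((b * c) * d) - (b * c) * (a * d) + (b * ((c * a) * d) - (c * a) * (b * d)) +
      (c * ((a * b) * d) - (a * b) * (c * d))) = 0 at h
  rw [← Nat.cast_smul_eq_nsmul ℂ, smul_eq_zero] at h
  exact h.resolve_left (by norm_num)

/-- In a Jordan algebra the commutator of two multiplications is a derivation. -/
lemma jordan_derivation (a c x y : J) :
    a * (c * (x * y)) - c * (a * (x * y)) =
      (a * (c * x) - c * (a * x)) * y + x * (a * (c * y) - c * (a * y)) := by
  -- Exchanging `a` and `c` and subtracting cancels all products of two products.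
  have h1 := jordan_linearized y x c a
  have h2 := jordan_linearized y x a c
  simp only [mul_sub, sub_mul]
  simp only [mul_comm] at h1 h2 ⊢
  linear_combination (norm := module) h2 - h1

end JordanDerivation

/-! ### Linearity and associativity of the generic trace. -/

section GenericTrace

variable {J : Type*} [NonAssocCommRing J] [Module ℂ J]

/-- Only the coefficient of `x ^ 2` is kept: it carries the information on `σ₁` and `σ₂` in the
comparisons below. -/
lemma coeff_eq_zero_of_linearIndependent {x : J} (hx : LinearIndependent ℂ ![1, x, x * x])
    {a b c : ℂ} (h : a • (x * x) + b • x + c • (1 : J) = 0) : a = 0 := by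
  have := Fintype.linearIndependent_iff.1 hx ![c, b, a]
    (by rw [← h]; simp [Fin.sum_univ_three]; abel) 2
  simpa using this

variable [SMulCommClass ℂ J J] [IsScalarTower ℂ J J]

/-- The derivative of the generic minimum polynomial relation. -/
lemma relation_derivative {σ₁ σ₂ σ₃ : J → ℂ}
    (hrel : ∀ x : J, x * (x * x) = σ₁ x • (x * x) - σ₂ x • x + σ₃ x • (1 : J))
    (x y : J) {d₁ d₂ d₃ : ℂ} (h₁ : HasDerivAt (fun t : ℂ => σ₁ (x + t • y)) d₁ 0)
    (h₂ : HasDerivAt (fun t : ℂ => σ₂ (x + t • y)) d₂ 0)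
    (h₃ : HasDerivAt (fun t : ℂ => σ₃ (x + t • y)) d₃ 0) :
    y * (x * x) + (2 : ℂ) • (x * (x * y)) =
      d₁ • (x * x) + (2 * σ₁ x) • (x * y) - d₂ • x - σ₂ x • y + d₃ • (1 : J) := by
  -- Testing against linear forms reduces the claim to scalar derivatives at `t = 0` along `x + t
  -- y`.
  rw [← sub_eq_zero, ← Module.forall_dual_apply_eq_zero_iff ℂ]
  intro φ
  have hsq (t : ℂ) : (x + t • y) * (x + t • y) = x * x + (2 * t) • (x * y) + (t ^ 2) • (y * y) := by
    simp only [add_mul, mul_add, smul_mul_assoc, mul_smul_comm, mul_comm y x]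
    module
  have hcub (t : ℂ) : φ ((x + t • y) * ((x + t • y) * (x + t • y))) =
      φ (x * (x * x)) + t * φ (y * (x * x) + (2 : ℂ) • (x * (x * y))) +
      t ^ 2 * φ (x * (y * y) + (2 : ℂ) • (y * (x * y))) + t ^ 3 * φ (y * (y * y)) := by
    rw [hsq]
    simp only [add_mul, mul_add, smul_mul_assoc, mul_smul_comm, map_add, map_smul, smul_eq_mul]
    ring
  have hl : HasDerivAt (fun t : ℂ => φ ((x + t • y) * ((x + t • y) * (x + t • y))))
      (φ (y * (x * x) + (2 : ℂ) • (x * (x * y)))) 0 := by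
    simp only [hcub]
    have h := ((((hasDerivAt_id (0 : ℂ)).mul_const
      (φ (y * (x * x) + (2 : ℂ) • (x * (x * y))))).const_add (φ (x * (x * x)))).add
      (((hasDerivAt_id (0 : ℂ)).pow 2).mul_const (φ (x * (y * y) + (2 : ℂ) • (y * (x * y)))))).add
      (((hasDerivAt_id (0 : ℂ)).pow 3).mul_const (φ (y * (y * y))))
    refine h.congr_deriv ?_
    simp
  have hq : HasDerivAt (fun t : ℂ => φ ((x + t • y) * (x + t • y))) (2 * φ (x * y)) 0 := by
    simp only [hsq, map_add, map_smul, smul_eq_mul]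
    have h := ((((hasDerivAt_id (0 : ℂ)).const_mul 2).mul_const (φ (x * y))).const_add
      (φ (x * x))).add (((hasDerivAt_id (0 : ℂ)).pow 2).mul_const (φ (y * y)))
    refine h.congr_deriv ?_
    simp
  have hx : HasDerivAt (fun t : ℂ => φ (x + t • y)) (φ y) 0 := by
    simp only [map_add, map_smul, smul_eq_mul]
    simpa using ((hasDerivAt_id (0 : ℂ)).mul_const (φ y)).const_add (φ x)
  have hr := ((h₁.mul hq).sub (h₂.mul hx)).add (h₃.mul_const (φ 1))
  have := hl.unique (hr.congr_of_eventuallyEq (Filter.Eventually.of_forall fun t => by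
    have h := congrArg φ (hrel (x + t • y))
    rw [map_add φ, map_sub φ, map_smul φ, map_smul φ, map_smul φ] at h
    exact h))
  simp only [zero_smul, add_zero] at this
  rw [map_sub, this]
  simp only [map_add, map_sub, map_smul, smul_eq_mul]
  ring

variable [FiniteDimensional ℂ J] [IsCommJordan J]

variable (J) in
/-- The generic trace `σ₁` is a linear form which is associative, takes the value three at the
unit, and determines `σ₂`. -/
theorem exists_generic_trace (hJ : HasJordanRank J 3) :
    ∃ τ : Module.Dual ℂ J, (∀ x, genericCoeff 1 x = τ x) ∧ τ 1 = 3 ∧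
      (∀ x y z, τ (x * y * z) = τ (x * (y * z))) ∧
      ∀ x, genericCoeff 2 x = (τ x ^ 2 - τ (x * x)) / 2 := by
  obtain ⟨hpoly, hrel⟩ := genericCoeff_polynomial_and_relation J hJ
  have hp1 := hpoly 1 (by simp)
  have hp2 := hpoly 2 (by simp)
  have hp3 := hpoly 3 (by simp)
  set σ₁ : J → ℂ := genericCoeff 1
  set σ₂ : J → ℂ := genericCoeff 2
  set σ₃ : J → ℂ := genericCoeff 3
  have hli := forGeneral_linearIndependent J hJ
  -- Compare the relation at `c x` with `c ^ 3` times the relation at `x`.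
  have hhom (c : ℂ) (hc : c ≠ 0) (x : J) : σ₁ (c • x) = c * σ₁ x := by
    refine congrFun (eq_of_forGeneral (f := fun x => σ₁ (c • x)) (g := fun x => c * σ₁ x)
      (comp_mem_polyFun (c • LinearMap.id (R := ℂ) (M := J)).isPolyMap hp1)
      (mul_mem_polyFun (const_mem_polyFun c) hp1) (hli.mono fun x hx => ?_)) x
    have h1 := hrel x
    have h2 := hrel (c • x)
    simp only [smul_mul_assoc, mul_smul_comm] at h2
    have h3 := coeff_eq_zero_of_linearIndependent hx
      (a := c ^ 2 * σ₁ (c • x) - c ^ 3 * σ₁ x) (b := c ^ 3 * σ₂ x - c * σ₂ (c • x))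
      (c := σ₃ (c • x) - c ^ 3 * σ₃ x) (by
        linear_combination (norm := module) c ^ 3 • h1 - h2)
    have h4 : c ^ 2 * (σ₁ (c • x) - c * σ₁ x) = 0 := by linear_combination h3
    have := (mul_eq_zero.1 h4).resolve_left (pow_ne_zero 2 hc)
    linear_combination this
  obtain ⟨τ, hτ⟩ := exists_differential_of_mem_polyFun hp1 0
  -- A polynomial function homogeneous of degree one equals its differential at the origin.
  have hστ (x : J) : σ₁ x = τ x := by
    obtain ⟨P, hP⟩ := exists_polynomial_of_mem_polyFun hp1 0 x
    have hPX : P = .C (σ₁ x) * .X := by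
      refine Polynomial.eq_of_infinite_eval_eq _ _ (Set.Infinite.mono (s := {0}ᶜ) ?_
        (Set.finite_singleton (0 : ℂ)).infinite_compl)
      intro t ht
      rw [Set.mem_ofPred_eq, ← hP, zero_add, hhom t ht, Polynomial.eval_mul, Polynomial.eval_C,
        Polynomial.eval_X, mul_comm]
    refine HasDerivAt.unique (f := fun t : ℂ => σ₁ (0 + t • x)) (x := 0) ?_ (hτ x)
    simp only [hP, hPX, Polynomial.eval_mul, Polynomial.eval_C, Polynomial.eval_X]
    simpa using (hasDerivAt_id (0 : ℂ)).const_mul (σ₁ x)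
  have hlin (x : J) : ∃ d₂ d₃ : Module.Dual ℂ J, ∀ y, y * (x * x) + (2 : ℂ) • (x * (x * y)) =
      τ y • (x * x) + (2 * τ x) • (x * y) - d₂ y • x - σ₂ x • y + d₃ y • (1 : J) := by
    obtain ⟨d₂, h₂⟩ := exists_differential_of_mem_polyFun hp2 x
    obtain ⟨d₃, h₃⟩ := exists_differential_of_mem_polyFun hp3 x
    refine ⟨d₂, d₃, fun y => ?_⟩
    rw [← hστ x]
    refine relation_derivative hrel x y ?_ (h₂ y) (h₃ y)
    simp only [hστ, map_add, map_smul, smul_eq_mul]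
    simpa using ((hasDerivAt_id (0 : ℂ)).mul_const (τ y)).const_add (τ x)
  -- In the direction `e` the left side of the differentiated relation is `3 x ^ 2`.
  have hone : τ 1 = 3 := by
    obtain ⟨x, hx⟩ := hli.exists
    obtain ⟨d₂, d₃, h⟩ := hlin x
    have h1 := h 1
    simp only [one_mul, mul_one] at h1
    have := coeff_eq_zero_of_linearIndependent hx (a := τ 1 - 3) (b := 2 * τ x - d₂ 1)
      (c := d₃ 1 - σ₂ x) (by linear_combination (norm := module) -h1)
    linear_combination this
  -- In the direction `x ^ 2` the left side is `3 x ^ 4`, as `x ^ 2 * x ^ 2 = x * x ^ 3` by the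
  -- Jordan identity; reducing `x ^ 4` and `x ^ 3` by the relation yields Newton's identity.
  have hnewton (x : J) : σ₂ x = (τ x ^ 2 - τ (x * x)) / 2 := by
    have hsq : (fun x : J => τ (x * x)) ∈ polyFun J :=
      IsPolyMap.bilin (LinearMap.mul ℂ J) LinearMap.id.isPolyMap LinearMap.id.isPolyMap τ
    refine congrFun (eq_of_forGeneral (g := fun x => (τ x ^ 2 - τ (x * x)) / 2) hp2 ?_
      (hli.mono fun x hx => ?_)) x
    · simpa only [div_eq_mul_inv] using mul_mem_polyFun
        (sub_mem_polyFun (pow_mem_polyFun (dual_mem_polyFun τ) 2) hsq) (const_mem_polyFun 2⁻¹)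
    · obtain ⟨d₂, d₃, h⟩ := hlin x
      have h1 := h (x * x)
      have h2 := hrel x
      rw [hστ] at h2
      have h3 := congrArg (x * ·) h2
      simp only [mul_add, mul_sub, mul_smul_comm, mul_one] at h3
      have h4 : x * x * (x * x) = x * (x * (x * x)) := IsCommJordan.lmul_comm_rmul_rmul x x
      have := coeff_eq_zero_of_linearIndependent hx (a := τ x ^ 2 - 2 * σ₂ x - τ (x * x))
        (b := 3 * σ₃ x + d₂ (x * x) - τ x * σ₂ x) (c := τ x * σ₃ x - d₃ (x * x)) (by
          linear_combination (norm := module) h1 - h4 - (3 : ℂ) • h3 - τ x • h2)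
      linear_combination -(1 / 2) * this
  -- Applying the derivation `D` to the relation treats the `σ_i x` as constants, while
  -- differentiating along `D x` does not. The difference has `τ (D x)` as coefficient of `x ^ 2`.
  have hder (a c x : J) : τ (a * (c * x)) = τ (c * (a * x)) := by
    let D : J →ₗ[ℂ] J := LinearMap.mulLeft ℂ a ∘ₗ LinearMap.mulLeft ℂ c -
      LinearMap.mulLeft ℂ c ∘ₗ LinearMap.mulLeft ℂ a
    have hD (x : J) : D x = a * (c * x) - c * (a * x) := rfl
    have hDmul (x y : J) : D (x * y) = D x * y + x * D y := jordan_derivation a c x y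
    have hD1 : D 1 = 0 := by simp [hD, mul_comm]
    rw [← sub_eq_zero, ← map_sub]
    refine eq_zero_of_forGeneral (f := fun x => τ (D x)) (dual_mem_polyFun (τ ∘ₗ D))
      (hli.mono fun x hx => ?_) x
    obtain ⟨d₂, d₃, h⟩ := hlin x
    have h1 := h (D x)
    have h2 := congrArg D (hrel x)
    rw [hστ] at h2
    simp only [hDmul, map_add, map_sub, map_smul, hD1, mul_add, mul_comm (D x) x] at h2
    exact coeff_eq_zero_of_linearIndependent hx (b := -d₂ (D x)) (c := d₃ (D x)) (by
      linear_combination (norm := module) h2 - h1)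
  refine ⟨τ, hστ, hone, fun x y z => ?_, hnewton⟩
  rw [mul_comm (x * y) z, hder, mul_comm z y]

end GenericTrace

/-! ### Adjoint and norm identities derived from the trace. -/

section CubicTrace

variable {J : Type*} [NonAssocCommRing J] [Module ℂ J]

/-- The adjoint defined by a linear form. -/
def traceAdj (τ : Module.Dual ℂ J) (x : J) : J :=
  x * x - τ x • x + ((τ x ^ 2 - τ (x * x)) / 2) • (1 : J)

/-- The cubic form defined by a linear form. -/
def traceNorm (τ : Module.Dual ℂ J) (x : J) : ℂ := τ (x * traceAdj τ x) / 3

/-- The polarization of the adjoint. -/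
def traceCross (τ : Module.Dual ℂ J) (x y : J) : J :=
  (2 : ℂ) • (x * y) - τ x • y - τ y • x + (τ x * τ y - τ (x * y)) • (1 : J)

/-- The properties of the generic trace of a Jordan algebra of rank three. -/
structure IsCubicTrace (τ : Module.Dual ℂ J) : Prop where
  map_one : τ 1 = 3
  assoc : ∀ x y z, τ (x * y * z) = τ (x * (y * z))
  sq_mul_sq : ∀ x : J, x * x * (x * x) = x * (x * (x * x))
  mul_adj : ∀ x, x * traceAdj τ x = traceNorm τ x • (1 : J)

variable {τ : Module.Dual ℂ J}

lemma traceAdj_add (x y : J) :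
    traceAdj τ (x + y) = traceAdj τ x + traceCross τ x y + traceAdj τ y := by
  simp only [traceAdj, traceCross, add_mul, mul_add, map_add, mul_comm y x]
  module

lemma ne_zero_of_traceNorm_ne_zero {x : J} (hx : traceNorm τ x ≠ 0) : x ≠ 0 := by
  rintro rfl
  exact hx (by simp [traceNorm])

namespace IsCubicTrace

lemma adj_one (hτ : IsCubicTrace τ) : traceAdj τ 1 = 1 := by
  simp only [traceAdj, hτ.map_one, mul_one]
  module

lemma one_ne_zero (hτ : IsCubicTrace τ) : (1 : J) ≠ 0 := by
  intro h
  have := hτ.map_one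
  rw [h, map_zero] at this
  norm_num at this

lemma trace_adj (hτ : IsCubicTrace τ) (x : J) : τ (traceAdj τ x) = (τ x ^ 2 - τ (x * x)) / 2 := by
  simp only [traceAdj, map_add, map_sub, map_smul, smul_eq_mul, hτ.map_one]
  ring

lemma norm_one (hτ : IsCubicTrace τ) : traceNorm τ 1 = 1 := by
  simp [traceNorm, hτ.adj_one, hτ.map_one]

lemma adj_ne_zero (hτ : IsCubicTrace τ) {x : J} (hx : traceNorm τ x ≠ 0) : traceAdj τ x ≠ 0 := by
  intro h
  have := hτ.mul_adj x
  rw [h, mul_zero] at this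
  exact smul_ne_zero hx hτ.one_ne_zero this.symm

end IsCubicTrace

variable [SMulCommClass ℂ J J]

/-- Newton's formula for the third elementary symmetric function in terms of power sums. -/
lemma traceNorm_eq (x : J) :
    traceNorm τ x = (τ x ^ 3 - 3 * τ x * τ (x * x) + 2 * τ (x * (x * x))) / 6 := by
  simp only [traceNorm, traceAdj, mul_add, mul_sub, mul_smul_comm, map_add, map_sub, map_smul,
    smul_eq_mul, mul_one]
  ring

variable [IsScalarTower ℂ J J]

lemma traceAdj_smul (c : ℂ) (x : J) : traceAdj τ (c • x) = c ^ 2 • traceAdj τ x := by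
  simp only [traceAdj, smul_mul_assoc, mul_smul_comm, map_smul, smul_eq_mul]
  module

lemma traceNorm_smul (c : ℂ) (x : J) : traceNorm τ (c • x) = c ^ 3 * traceNorm τ x := by
  simp only [traceNorm, traceAdj_smul, smul_mul_assoc, mul_smul_comm, map_smul, smul_eq_mul]
  ring

variable (J) in
-- From here on the Jordan structure enters only through `IsCubicTrace`. The identity `x x^# = N(x)
-- e` is the minimum relation, and its trace gives `3 N(x)`.
lemma exists_isCubicTrace [FiniteDimensional ℂ J] [IsCommJordan J] (hJ : HasJordanRank J 3) :
    ∃ τ : Module.Dual ℂ J, IsCubicTrace τ ∧ (∀ x, cubicAdjoint x = traceAdj τ x) ∧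
      ∀ x, cubicNorm x = traceNorm τ x := by
  obtain ⟨τ, h1, hone, hassoc, h2⟩ := exists_generic_trace J hJ
  have hrel := (genericCoeff_polynomial_and_relation J hJ).2
  have hadj (x : J) : cubicAdjoint x = traceAdj τ x := by
    rw [cubicAdjoint, traceAdj, h1, h2]
  have hmul (x : J) : x * traceAdj τ x = cubicNorm x • (1 : J) := by
    have := hrel x
    rw [h1, h2] at this
    rw [traceAdj, mul_add, mul_sub, mul_smul_comm, mul_smul_comm, this, mul_one, cubicNorm]
    module
  have hnorm (x : J) : cubicNorm x = traceNorm τ x := by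
    rw [traceNorm, hmul, map_smul, hone, smul_eq_mul]
    ring
  exact ⟨τ, ⟨hone, hassoc, fun x => IsCommJordan.lmul_comm_rmul_rmul x x,
    fun x => by rw [hmul, hnorm]⟩, hadj, hnorm⟩

namespace IsCubicTrace

/-- Associativity of `τ` identifies all trace monomials of bidegree `(2, 1)`, and likewise those of
bidegree `(1, 2)`. -/
lemma norm_add (hτ : IsCubicTrace τ) (x y : J) : traceNorm τ (x + y) = traceNorm τ x + τ (traceAdj τ x * y) +
    τ (x * traceAdj τ y) + traceNorm τ y := by
  have h1 : τ (y * (x * x)) = τ (x * (x * y)) := by rw [mul_comm, hτ.assoc]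
  have h3 : τ (x * (y * y)) = τ (y * (y * x)) := by rw [mul_comm, hτ.assoc]
  have h4 : τ (y * (x * y)) = τ (y * (y * x)) := by rw [mul_comm y x]
  have h5 : τ (x * x * y) = τ (x * (x * y)) := hτ.assoc _ _ _
  simp only [traceNorm_eq, traceAdj, add_mul, mul_add, sub_mul, mul_sub, smul_mul_assoc,
    mul_smul_comm, map_add, map_sub, map_smul, smul_eq_mul, one_mul, mul_one, h1, h3, h4, h5,
    mul_comm y x]
  ring

/-- The key is `x ^ 2 * x^# = N(x) x`, obtained by multiplying `x x^# = N(x) e` by `x` and using `x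
^ 2 * x ^ 2 = x * x ^ 3`. -/
lemma adj_sq (hτ : IsCubicTrace τ) (x : J) : traceAdj τ x * traceAdj τ x = traceNorm τ x • x -
    (τ x * traceNorm τ x) • (1 : J) + ((τ x ^ 2 - τ (x * x)) / 2) • traceAdj τ x := by
  have h1 : x * x * traceAdj τ x = traceNorm τ x • x := by
    have h := congrArg (x * ·) (hτ.mul_adj x)
    simp only [traceAdj, mul_add, mul_sub, mul_smul_comm, mul_one] at h ⊢
    rw [hτ.sq_mul_sq, ← h, mul_comm (x * x) x]
  have h2 : traceAdj τ x * traceAdj τ x = x * x * traceAdj τ x - τ x • (x * traceAdj τ x) +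
      ((τ x ^ 2 - τ (x * x)) / 2) • traceAdj τ x := by
    nth_rw 1 [traceAdj]
    rw [add_mul, sub_mul, smul_mul_assoc, smul_mul_assoc, one_mul]
  rw [h2, h1, hτ.mul_adj]
  module

/-- All other terms cancel because `τ(x^#) = σ₂` and, by `adj_sq`, `τ((x^#) ^ 2) = σ₂ ^ 2 - 2 σ₁ N`.
-/
lemma adj_adj (hτ : IsCubicTrace τ) (x : J) : traceAdj τ (traceAdj τ x) = traceNorm τ x • x := by
  rw [traceAdj, hτ.adj_sq, hτ.trace_adj]
  simp only [map_add, map_sub, map_smul, smul_eq_mul, hτ.map_one, hτ.trace_adj]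
  module

lemma norm_adj (hτ : IsCubicTrace τ) (x : J) : traceNorm τ (traceAdj τ x) = traceNorm τ x ^ 2 := by
  rw [traceNorm, hτ.adj_adj, mul_smul_comm, map_smul, mul_comm, hτ.mul_adj, map_smul, hτ.map_one,
    smul_eq_mul, smul_eq_mul]
  ring

end IsCubicTrace

lemma isPolyMap_traceAdj [FiniteDimensional ℂ J] (τ : Module.Dual ℂ J) :
    IsPolyMap (traceAdj τ) := by
  have hsq : IsPolyMap fun x : J => x * x :=
    IsPolyMap.bilin (LinearMap.mul ℂ J) LinearMap.id.isPolyMap LinearMap.id.isPolyMap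
  have h2 : (fun x : J => (τ x ^ 2 - τ (x * x)) / 2) ∈ polyFun J := by
    simpa only [div_eq_mul_inv] using mul_mem_polyFun
      (sub_mem_polyFun (pow_mem_polyFun (dual_mem_polyFun τ) 2) (hsq τ)) (const_mem_polyFun 2⁻¹)
  exact (hsq.sub (.smul (dual_mem_polyFun τ) LinearMap.id.isPolyMap)).add
    (.smul h2 (isPolyMap_const 1))

lemma traceNorm_mem_polyFun [FiniteDimensional ℂ J] (τ : Module.Dual ℂ J) :
    traceNorm τ ∈ polyFun J := by
  have := mul_mem_polyFun (IsPolyMap.bilin (LinearMap.mul ℂ J) LinearMap.id.isPolyMap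
    (isPolyMap_traceAdj τ) τ) (const_mem_polyFun 3⁻¹)
  exact this

end CubicTrace

/-! ### Prime chains and algebraic independence. -/

section PrimeChains

variable {k A : Type*} [Field k] [CommRing A] [Algebra k A]

/-- Along a chain of `n + 1` primes one can choose `n` elements that are algebraically independent
modulo the smallest prime of the chain. -/
lemma exists_algebraicIndependent_of_prime_chain {n : ℕ} (P : Fin (n + 1) → Ideal A)
    (hP : ∀ i, (P i).IsPrime) (hlt : StrictMono P) :
    ∃ f : Fin n → A, ∀ G : MvPolynomial (Fin n) k, MvPolynomial.aeval f G ∈ P 0 → G = 0 := by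
  induction n with
  | zero =>
    refine ⟨Fin.elim0, fun G hG => ?_⟩
    rw [MvPolynomial.eq_C_of_isEmpty G, MvPolynomial.aeval_C] at hG
    by_contra hne
    have hc : G.coeff 0 ≠ 0 := by
      intro h
      apply hne
      rw [MvPolynomial.eq_C_of_isEmpty G, h, map_zero]
    exact (hP 0).ne_top (Ideal.eq_top_of_isUnit_mem _ hG ((isUnit_iff_ne_zero.2 hc).map _))
  | succ n ih =>
    obtain ⟨f', hf'⟩ := ih (fun i => P i.succ) (fun i => hP _)
      (hlt.comp (Fin.strictMono_succ))
    obtain ⟨a, ha1, ha0⟩ := SetLike.exists_of_lt (hlt (Fin.succ_pos 0 : (0 : Fin (n + 2)) < Fin.succ 0))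
    refine ⟨Fin.cons a f', fun G hG => ?_⟩
    let ψ : Polynomial (MvPolynomial (Fin n) k) →ₐ[k] A :=
      Polynomial.eval₂AlgHom (MvPolynomial.aeval f') a fun _ => Commute.all _ _
    have hψ : ψ.comp (MvPolynomial.finSuccEquiv k n).toAlgHom =
        MvPolynomial.aeval (Fin.cons a f') := by
      refine MvPolynomial.algHom_ext fun i => ?_
      refine Fin.cases ?_ (fun j => ?_) i
      · simp [ψ, MvPolynomial.finSuccEquiv_X_zero]
      · simp [ψ, MvPolynomial.finSuccEquiv_X_succ]
    -- Take a relation in `a` modulo `P 0`. Modulo the next prime, which contains `a`, only its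
    -- constant term survives, and this is zero by the choice of `f'`. The remaining factor `a` lies
    -- outside `P 0` and can be cancelled, which lowers the degree.
    have hinj (N : ℕ) : ∀ p : Polynomial (MvPolynomial (Fin n) k), p.natDegree < N →
        ψ p ∈ P 0 → p = 0 := by
      induction N with
      | zero => intro p hp; omega
      | succ N ihN =>
        intro p hp hmem
        have hsplit : ψ p = ψ p.divX * a + MvPolynomial.aeval f' (p.coeff 0) := by
          conv_lhs => rw [← p.divX_mul_X_add]
          simp [ψ]
        have h0 : p.coeff 0 = 0 := by
          apply hf'
          have h1 : ψ p ∈ P (Fin.succ 0) := (hlt (Fin.succ_pos 0)).le hmem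
          rw [hsplit] at h1
          exact ((P (Fin.succ 0)).add_mem_iff_right (Ideal.mul_mem_left _ _ ha1)).1 h1
        rw [hsplit, h0, map_zero, add_zero] at hmem
        have hdiv : ψ p.divX ∈ P 0 := ((hP 0).mem_or_mem hmem).resolve_right ha0
        by_cases hd : p.natDegree = 0
        · rw [Polynomial.eq_C_of_natDegree_eq_zero hd, h0, map_zero]
        · have hX := ihN p.divX (by rw [Polynomial.natDegree_divX_eq_natDegree_tsub_one]; omega) hdiv
          rw [← p.divX_mul_X_add, hX, h0, map_zero, zero_mul, add_zero]
    have hG' : ψ (MvPolynomial.finSuccEquiv k n G) ∈ P 0 := by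
      have := DFunLike.congr_fun hψ G
      rw [← this] at hG
      exact hG
    exact (map_eq_zero_iff _ (MvPolynomial.finSuccEquiv k n).injective).1
      (hinj _ _ (Nat.lt_succ_self _) hG')

end PrimeChains

/-! ### Krull dimension of projective sets via ideals of cones. -/

section ConeIdeals

variable {V W : Type*} [AddCommGroup V] [Module ℂ V] [AddCommGroup W] [Module ℂ W]

/-- The coordinates generate `polyFun W`, so its transcendence degree is at most that of a
polynomial ring in `dim W` variables. -/
lemma card_le_finrank_of_algebraicIndependent [FiniteDimensional ℂ W] {n : ℕ}
    {f : Fin n → polyFun W} (hf : AlgebraicIndependent ℂ f) : n ≤ Module.finrank ℂ W := by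
  let b := Module.finBasis ℂ W
  let φ : MvPolynomial (Fin (Module.finrank ℂ W)) ℂ →ₐ[ℂ] polyFun W :=
    MvPolynomial.aeval fun i => ⟨fun w => b.coord i w, dual_mem_polyFun _⟩
  have hφ : Function.Surjective φ := by
    rintro ⟨g, hg⟩
    induction hg using polyFun_induction with
    | hl l =>
      refine ⟨∑ i, .C (l (b i)) * .X i, Subtype.ext (funext fun w => ?_)⟩
      conv_rhs => rw [← b.sum_repr w]
      simp only [φ, map_sum, map_mul, MvPolynomial.aeval_C, MvPolynomial.aeval_X]
      rw [AddSubmonoidClass.coe_finsetSum, Finset.sum_apply]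
      exact Finset.sum_congr rfl fun i _ => by
        rw [map_smul, smul_eq_mul, mul_comm]
        rfl
    | hc c => exact ⟨.C c, by simp [φ]; rfl⟩
    | ha f g hf hg ihf ihg =>
      obtain ⟨p, hp⟩ := ihf
      obtain ⟨q, hq⟩ := ihg
      exact ⟨p + q, by rw [map_add, hp, hq]; rfl⟩
    | hm f g hf hg ihf ihg =>
      obtain ⟨p, hp⟩ := ihf
      obtain ⟨q, hq⟩ := ihg
      exact ⟨p * q, by rw [map_mul, hp, hq]; rfl⟩
  have h1 := hf.lift_cardinalMk_le_trdeg
  have h2 := lift_trdeg_le_of_surjective φ hφ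
  simp only [Cardinal.mk_fin, Cardinal.lift_natCast, Cardinal.lift_uzero,
    MvPolynomial.trdeg_of_isDomain] at h1 h2
  exact_mod_cast h1.trans h2

lemma isHomogeneousPoly_zero (d : ℕ) : IsHomogeneousPoly d fun _ : V => 0 :=
  ⟨const_mem_polyFun 0, by simp⟩

/-- The homogeneous expansion of a polynomial function. -/
lemma exists_homogeneous_expansion {f : V → ℂ} (hf : f ∈ polyFun V) :
    ∃ Q : V → Polynomial ℂ, (∀ v c, f (c • v) = (Q v).eval c) ∧
      ∀ d, IsHomogeneousPoly d fun v => (Q v).coeff d := by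
  induction hf using polyFun_induction with
  | hl l =>
    refine ⟨fun v => .C (l v) * .X, fun v c => by simp; ring, fun d => ?_⟩
    by_cases hd : d = 1
    · subst hd
      simpa using isHomogeneousPoly_dual l
    · simpa [Polynomial.coeff_X, Ne.symm hd] using
        isHomogeneousPoly_zero (V := V) d
  | hc a =>
    refine ⟨fun v => .C a, fun v c => by simp, fun d => ?_⟩
    by_cases hd : d = 0
    · subst hd
      exact ⟨by simpa using const_mem_polyFun a, by simp⟩
    · simpa [Polynomial.coeff_C, hd] using
        isHomogeneousPoly_zero (V := V) d
  | ha f g _ _ hf hg =>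
    obtain ⟨P, hP, hP'⟩ := hf
    obtain ⟨Q, hQ, hQ'⟩ := hg
    refine ⟨fun v => P v + Q v, fun v c => by simp [hP, hQ], fun d => ⟨?_, fun c v => ?_⟩⟩
    · simpa using add_mem_polyFun (hP' d).1 (hQ' d).1
    · have h1 := (hP' d).2 c v
      have h2 := (hQ' d).2 c v
      simp only [Polynomial.coeff_add, h1, h2]
      ring
  | hm f g _ _ hf hg =>
    obtain ⟨P, hP, hP'⟩ := hf
    obtain ⟨Q, hQ, hQ'⟩ := hg
    refine ⟨fun v => P v * Q v, fun v c => by simp [hP, hQ], fun d => ⟨?_, fun c v => ?_⟩⟩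
    · simp only [Polynomial.coeff_mul]
      exact sum_mem_polyFun _ fun i _ => mul_mem_polyFun (hP' _).1 (hQ' _).1
    · simp only [Polynomial.coeff_mul, Finset.mul_sum]
      refine Finset.sum_congr rfl fun i hi => ?_
      have h1 := (hP' i.1).2 c v
      have h2 := (hQ' i.2).2 c v
      beta_reduce at h1 h2
      rw [h1, h2, ← Finset.HasAntidiagonal.mem_antidiagonal.1 hi, pow_add]
      ring

/-- The ideal of the affine cone over a subset of the projective space. -/
def coneIdeal (Z : Set (ℙ ℂ V)) : Ideal (polyFun V) where
  carrier := {f | ∀ p ∈ Z, ∀ c : ℂ, f.1 (c • p.rep) = 0}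
  add_mem' hf hg p hp c := by simp [hf p hp c, hg p hp c]
  zero_mem' := by simp
  smul_mem' g f hf p hp c := by simp [hf p hp c]

lemma mem_coneIdeal {Z : Set (ℙ ℂ V)} {f : polyFun V} :
    f ∈ coneIdeal Z ↔ ∀ p ∈ Z, ∀ c : ℂ, f.1 (c • p.rep) = 0 := Iff.rfl

lemma IsHomogeneousPoly.mem_coneIdeal {d : ℕ} {f : V → ℂ} (hf : IsHomogeneousPoly d f)
    {Z : Set (ℙ ℂ V)} : ⟨f, hf.1⟩ ∈ coneIdeal Z ↔ ∀ p ∈ Z, f p.rep = 0 := by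
  rw [_root_.mem_coneIdeal]
  refine ⟨fun h p hp => by simpa using h p hp 1, fun h p hp c => ?_⟩
  exact (hf.2 c p.rep).trans (by rw [h p hp, mul_zero])

/-- If `f` and `g` are outside the ideal, each has a homogeneous component that is non-zero
somewhere on `Z`. By irreducibility both are non-zero at one point, and on the line of that point `f
g` is a product of two non-zero polynomials in the scalar. -/
lemma isPrime_coneIdeal {Z : Set (ℙ ℂ V)} (hZ : @IsIrreducible _ (projZariski V) Z) :
    (coneIdeal Z).IsPrime := by
  let := projZariski V
  constructor
  · intro h
    obtain ⟨p, hp⟩ := hZ.nonempty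
    have : (1 : polyFun V) ∈ coneIdeal Z := h ▸ Submodule.mem_top
    exact one_ne_zero (mem_coneIdeal.1 this p hp 0)
  · intro f g hfg
    by_contra! hne
    simp only [mem_coneIdeal, not_forall] at hne
    obtain ⟨⟨p, hp, c, hc⟩, ⟨q, hq, c', hc'⟩⟩ := hne
    obtain ⟨P, hP, hP'⟩ := exists_homogeneous_expansion f.2
    obtain ⟨Q, hQ, hQ'⟩ := exists_homogeneous_expansion g.2
    have hPp : P p.rep ≠ 0 := by
      intro h
      exact hc (by rw [hP, h, Polynomial.eval_zero])
    have hQq : Q q.rep ≠ 0 := by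
      intro h
      exact hc' (by rw [hQ, h, Polynomial.eval_zero])
    obtain ⟨d, hd⟩ := not_forall.1 (mt Polynomial.ext hPp)
    obtain ⟨e, he⟩ := not_forall.1 (mt Polynomial.ext hQq)
    obtain ⟨r, hr, hrP, hrQ⟩ := hZ.2 _ _ (isOpen_homogeneous_ne_zero (hP' d))
      (isOpen_homogeneous_ne_zero (hQ' e)) ⟨p, hp, by simpa using hd⟩ ⟨q, hq, by simpa using he⟩
    have hmul : P r.rep * Q r.rep ≠ 0 := mul_ne_zero
      (fun h => hrP (by rw [h, Polynomial.coeff_zero]))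
      (fun h => hrQ (by rw [h, Polynomial.coeff_zero]))
    refine hmul (Polynomial.funext fun t => ?_)
    have := mem_coneIdeal.1 hfg r hr t
    rw [Polynomial.eval_mul, ← hP, ← hQ, Polynomial.eval_zero]
    exact this

/-- The pullback of polynomial functions along a polynomial map. -/
def polyPullback {F : W → V} (hF : IsPolyMap F) : polyFun V →ₐ[ℂ] polyFun W where
  toFun f := ⟨fun w => f.1 (F w), comp_mem_polyFun hF f.2⟩
  map_one' := rfl
  map_mul' _ _ := rfl
  map_zero' := rfl
  map_add' _ _ := rfl
  commutes' _ := rfl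

/-- A chain of primes above the ideal of the image of `W` has length at most `dim W`. -/
lemma length_le_finrank_of_prime_chain [FiniteDimensional ℂ W] {F : W → V} (hF : IsPolyMap F)
    {n : ℕ} (P : Fin (n + 1) → Ideal (polyFun V)) (hP : ∀ i, (P i).IsPrime) (hlt : StrictMono P)
    (hker : RingHom.ker (polyPullback hF) ≤ P 0) : n ≤ Module.finrank ℂ W := by
  obtain ⟨f, hf⟩ := exists_algebraicIndependent_of_prime_chain (k := ℂ) P hP hlt
  refine card_le_finrank_of_algebraicIndependent (f := fun i => polyPullback hF (f i)) ?_
  rw [algebraicIndependent_iff]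
  intro G hG
  refine hf G (hker ?_)
  rw [RingHom.mem_ker, ← hG]
  exact (DFunLike.congr_fun (MvPolynomial.comp_aeval f (polyPullback hF)) G)

/-- If the cone over `X` is contained in the closure of the image of a polynomial map from a space
of dimension `m + 1`, then `X` has dimension at most `m`. -/
theorem projDim_le_of_isPolyMap [FiniteDimensional ℂ W] {F : W → V} (hF : IsPolyMap F)
    {m : ℕ} (hW : Module.finrank ℂ W = m + 1) {X : Set (ℙ ℂ V)}
    (hX : ∀ f ∈ polyFun V, (∀ w, f (F w) = 0) → ∀ p ∈ X, ∀ c : ℂ, f (c • p.rep) = 0) :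
    projDim X ≤ m := by
  let := projZariski V
  let I : TopologicalSpace.IrreducibleCloseds X → Ideal (polyFun V) :=
    fun Z => coneIdeal (Subtype.val '' (Z : Set X))
  have hI (Z) : (I Z).IsPrime := isPrime_coneIdeal
    (Z.isIrreducible.image _ continuous_subtype_val.continuousOn)
  have hIlt {Z Z' : TopologicalSpace.IrreducibleCloseds X} (h : Z < Z') : I Z' < I Z := by
    refine lt_of_le_not_ge (fun f hf p hp => hf p (Set.image_mono h.le hp)) fun hle => ?_
    obtain ⟨p, hp', hp⟩ := SetLike.exists_of_lt h
    obtain ⟨U, hU, hUp⟩ := isOpen_induced_iff.1 Z.isClosed.isOpen_compl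
    have hpU : p.1 ∈ U := by
      have : p ∈ (Z : Set X)ᶜ := hp
      rwa [← hUp] at this
    obtain ⟨d, f, hf, hfp, hfU⟩ := isOpen_projZariski_iff hU hpU
    refine hfp (hf.mem_coneIdeal.1 (hle (hf.mem_coneIdeal.2 ?_)) p.1 ⟨p, hp', rfl⟩)
    rintro _ ⟨q, hq, rfl⟩
    by_contra hfq
    have : q ∈ Subtype.val ⁻¹' U := hfU _ hfq
    rw [hUp] at this
    exact this hq
  -- The ideal of the vertex of the cone lies strictly above every cone ideal; this extra step turns
  -- the bound `m + 1` into `m`.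
  let 𝔪 : Ideal (polyFun V) :=
    RingHom.ker ((Pi.evalRingHom (fun _ : V => ℂ) 0).comp (polyFun V).val.toRingHom)
  have h𝔪 : 𝔪.IsPrime := RingHom.ker_isPrime _
  have hI𝔪 (Z) : I Z < 𝔪 := by
    obtain ⟨p, hp⟩ := Z.isIrreducible.nonempty
    refine lt_of_le_not_ge (fun f hf => ?_) fun hle => ?_
    · have := hf p.1 ⟨p, hp, rfl⟩ 0
      rwa [zero_smul] at this
    · obtain ⟨l, hl⟩ : ∃ l : Module.Dual ℂ V, l p.1.rep ≠ 0 := by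
        by_contra! h
        exact p.1.rep_nonzero ((Module.forall_dual_apply_eq_zero_iff ℂ _).1 h)
      have h0 : (⟨_, dual_mem_polyFun l⟩ : polyFun V) ∈ 𝔪 := map_zero l
      exact hl ((isHomogeneousPoly_dual l).mem_coneIdeal.1 (hle h0) p.1 ⟨p, hp, rfl⟩)
  refine iSup_le fun s => ?_
  -- Passing to ideals reverses inclusions, hence `rev`; the vertex ideal goes on top.
  let P : Fin (s.length + 1 + 1) → Ideal (polyFun V) :=
    Fin.snoc (α := fun _ => Ideal (polyFun V)) (fun i => I (s i.rev)) 𝔪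
  have hPc (i : Fin (s.length + 1)) : P i.castSucc = I (s i.rev) := Fin.snoc_castSucc ..
  have hPl : P (Fin.last _) = 𝔪 := Fin.snoc_last ..
  have := length_le_finrank_of_prime_chain hF P
    (fun i => Fin.lastCases (by rw [hPl]; exact h𝔪) (fun i => by rw [hPc]; exact hI _) i)
    (fun i j => by
      refine Fin.lastCases (fun h => absurd h (Fin.le_last j).not_gt) (fun i => ?_) i
      refine Fin.lastCases (fun _ => ?_) (fun j h => ?_) j
      · rw [hPc, hPl]
        exact hI𝔪 _
      · rw [hPc, hPc]
        exact hIlt (s.strictMono (Fin.rev_lt_rev.2 (Fin.castSucc_lt_castSucc_iff.1 h))))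
    (by
      rintro f hf
      rw [show (0 : Fin (s.length + 1 + 1)) = Fin.castSucc 0 from rfl, hPc]
      rintro _ ⟨p, -, rfl⟩ c
      exact hX f.1 f.2 (fun w => congrFun (congrArg Subtype.val hf) w) p.1 p.2 c)
  rw [hW] at this
  exact_mod_cast Nat.le_of_succ_le_succ this

/-- A subset of the projective space that contains a copy of the affine space `W` has dimension at
least `dim W`. -/
theorem finrank_le_projDim [FiniteDimensional ℂ W] {g : W → ℙ ℂ V}
    (hg : @Continuous _ _ (affineZariski W) (projZariski V) g) {X : Set (ℙ ℂ V)}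
    (hgX : ∀ w, g w ∈ X) (hl : ∀ l : Module.Dual ℂ W, ∃ K : Set (ℙ ℂ V),
      IsClosed[projZariski V] K ∧ ∀ w, g w ∈ K ↔ l w = 0) :
    Module.finrank ℂ W ≤ projDim X := by
  let := projZariski V
  let := affineZariski W
  let b := Module.finBasis ℂ W
  -- A flag of coordinate subspaces. The vector `b j` lies in `S (j + 1)`, and the closed set
  -- attached to the `j`-th coordinate separates its image from the closure of the image of `S j`.
  let S : ℕ → Submodule ℂ W := fun j => ⨅ i : {i : Fin (Module.finrank ℂ W) // j ≤ i},
    LinearMap.ker (b.coord i)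
  have hS {j : ℕ} {w : W} : w ∈ S j ↔ ∀ i : Fin (Module.finrank ℂ W), j ≤ i → b.coord i w = 0 := by
    simp [S, Submodule.mem_iInf]
  let g' : W → X := fun w => ⟨g w, hgX w⟩
  have hg' : Continuous g' := hg.subtype_mk _
  let s : LTSeries (TopologicalSpace.IrreducibleCloseds X) :=
    { length := Module.finrank ℂ W
      toFun := fun j => ⟨closure (g' '' (S j : Set W)),
        ((isIrreducible_submodule (S j)).image _ hg'.continuousOn).closure, isClosed_closure⟩
      step := fun j => by
        refine lt_of_le_not_ge (closure_mono (Set.image_mono fun w hw => ?_)) fun hle => ?_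
        · rw [SetLike.mem_coe, hS] at hw ⊢
          exact fun i hi => hw i ((Nat.le_succ _).trans (by simpa using hi))
        · obtain ⟨K, hK, hKl⟩ := hl (b.coord j)
          have h1 : closure (g' '' (S j : Set W)) ⊆ Subtype.val ⁻¹' K := by
            refine closure_minimal ?_ (hK.preimage continuous_subtype_val)
            rintro _ ⟨w, hw, rfl⟩
            exact (hKl w).2 (hS.1 hw j le_rfl)
          have h2 : g' (b j) ∈ closure (g' '' (S (j + 1) : Set W)) := by
            refine subset_closure ⟨b j, hS.2 fun i hi => ?_, rfl⟩
            have hne : j ≠ i := by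
              rintro rfl
              omega
            simp [hne]
          have h3 : b.coord j (b j) = 0 := (hKl _).1 (h1 (hle (by simpa using h2)))
          simp at h3 }
  exact Order.LTSeries.length_le_krullDim s

end ConeIdeals

/-! ### Cones over closures. -/

section ConeOfClosure

variable {V : Type*} [AddCommGroup V] [Module ℂ V]

/-- A polynomial function vanishing on the cone over a set vanishes on the cone over its closure. -/
lemma eq_zero_of_mem_closure {S : Set (ℙ ℂ V)} {f : V → ℂ} (hf : f ∈ polyFun V)
    (hS : ∀ q ∈ S, ∀ c : ℂ, f (c • q.rep) = 0) {p : ℙ ℂ V} (hp : p ∈ closure[projZariski V] S)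
    (c : ℂ) : f (c • p.rep) = 0 := by
  obtain ⟨Q, hQ, hQ'⟩ := exists_homogeneous_expansion hf
  rw [mem_closure_projZariski_iff] at hp
  have : Q p.rep = 0 := by
    ext d
    refine hp d _ (hQ' d) fun q hq => ?_
    have : Q q.rep = 0 := Polynomial.funext fun t => by
      rw [← hQ, hS q hq, Polynomial.eval_zero]
    rw [this, Polynomial.coeff_zero]
  rw [hQ, this, Polynomial.eval_zero]

end ConeOfClosure

/-! ### Span, dimension and affine chart of the twisted cubic over `J`. -/

section TraceVariety

variable {J : Type*} [NonAssocCommRing J] [Module ℂ J]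

/-- The Zorn matrix with rows `(1, x)` and `(x^#, N(x))`. -/
def zornPoint (τ : Module.Dual ℂ J) (x : J) : ZornMatrices J :=
  (1, x, traceAdj τ x, traceNorm τ x)

lemma zornPoint_ne_zero (τ : Module.Dual ℂ J) (x : J) : zornPoint τ x ≠ 0 :=
  fun h => one_ne_zero (congrArg Prod.fst h)

/-- The parametrization of the twisted cubic attached to a trace form. -/
def zornMap (τ : Module.Dual ℂ J) (x : J) : ℙ ℂ (ZornMatrices J) :=
  Projectivization.mk ℂ (zornPoint τ x) (zornPoint_ne_zero τ x)

/-- The twisted cubic attached to a trace form. -/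
def traceVariety (τ : Module.Dual ℂ J) : Set (ℙ ℂ (ZornMatrices J)) :=
  closure[projZariski (ZornMatrices J)] (Set.range (zornMap τ))

lemma mem_traceVariety_iff {τ : Module.Dual ℂ J} {p : ℙ ℂ (ZornMatrices J)} :
    p ∈ traceVariety τ ↔ ∀ (d : ℕ) (f : ZornMatrices J → ℂ), IsHomogeneousPoly d f →
      (∀ x, f (zornPoint τ x) = 0) → f p.rep = 0 := by
  rw [traceVariety, mem_closure_projZariski_iff]
  refine forall_congr' fun d => forall_congr' fun f => forall_congr' fun hf => ?_
  rw [Set.forall_mem_range]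
  simp only [zornMap, hf.mk_rep_eq_zero_iff]

lemma zornMap_mem_traceVariety (τ : Module.Dual ℂ J) (x : J) : zornMap τ x ∈ traceVariety τ := by
  let := projZariski (ZornMatrices J)
  exact subset_closure ⟨x, rfl⟩

lemma twistedCubic_eq [SMulCommClass ℂ J J] {τ : Module.Dual ℂ J}
    (hadj : ∀ x, cubicAdjoint x = traceAdj τ x) (hnorm : ∀ x, cubicNorm x = traceNorm τ x) :
    twistedCubic J = traceVariety τ := by
  have : nuThree (J := J) = zornMap τ := by
    funext x
    simp only [nuThree, zornMap, zornPoint, hadj, hnorm]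
  rw [twistedCubic, traceVariety, this]

lemma traceAdj_zero (τ : Module.Dual ℂ J) : traceAdj τ 0 = 0 := by simp [traceAdj]

variable [SMulCommClass ℂ J J] [IsScalarTower ℂ J J]

/-- The trace variety spans the projective space. -/
lemma IsCubicTrace.isNondegenerate {τ : Module.Dual ℂ J} (hτ : IsCubicTrace τ) :
    IsNondegenerate (traceVariety τ) := by
  have hspan : Submodule.span ℂ (Set.range (zornPoint τ)) = ⊤ := by
    by_contra hne
    obtain ⟨l, hl0, hl⟩ := Submodule.exists_le_ker_of_lt_top _ (lt_top_iff_ne_top.2 hne)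
    have hz (x : J) : l (zornPoint τ x) = 0 := hl (Submodule.subset_span ⟨x, rfl⟩)
    let l₀ : ℂ →ₗ[ℂ] ℂ := l ∘ₗ LinearMap.inl ℂ ℂ (J × J × ℂ)
    let l' : J × J × ℂ →ₗ[ℂ] ℂ := l ∘ₗ LinearMap.inr ℂ ℂ (J × J × ℂ)
    let l₁ : J →ₗ[ℂ] ℂ := l' ∘ₗ LinearMap.inl ℂ J (J × ℂ)
    let l'' : J × ℂ →ₗ[ℂ] ℂ := l' ∘ₗ LinearMap.inr ℂ J (J × ℂ)
    let l₂ : J →ₗ[ℂ] ℂ := l'' ∘ₗ LinearMap.inl ℂ J ℂ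
    let l₃ : ℂ →ₗ[ℂ] ℂ := l'' ∘ₗ LinearMap.inr ℂ J ℂ
    have hsplit (s : ℂ) (x y : J) (t : ℂ) : l (s, x, y, t) = s * l₀ 1 + l₁ x + l₂ y + t * l₃ 1 := by
      have h0 : s * l₀ 1 = l₀ s := by rw [← smul_eq_mul, ← map_smul, smul_eq_mul, mul_one]
      have h3 : t * l₃ 1 = l₃ t := by rw [← smul_eq_mul, ← map_smul, smul_eq_mul, mul_one]
      rw [h0, h3]
      simp only [l₀, l₁, l₂, l₃, l', l'', LinearMap.comp_apply, LinearMap.inl_apply,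
        LinearMap.inr_apply, ← map_add]
      simp
    -- The entries of `ν(c x)` have degrees `0, 1, 2, 3` in `c`, so the coefficients of this cubic
    -- polynomial separate the blocks of `l`. The combinations below extract them from the values at
    -- `0, 1, -1, 2`.
    have hc (x : J) (c : ℂ) : l₀ 1 + c * l₁ x + c ^ 2 * l₂ (traceAdj τ x) +
        c ^ 3 * (traceNorm τ x * l₃ 1) = 0 := by
      have := hz (c • x)
      rw [zornPoint, hsplit, traceAdj_smul, traceNorm_smul, map_smul, map_smul, smul_eq_mul,
        smul_eq_mul] at this
      linear_combination this
    have h0 : l₀ 1 = 0 := by linear_combination hc 0 0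
    have h1 (x : J) : l₁ x = 0 := by
      linear_combination (-1 / 2) * hc x 0 + hc x 1 - 1 / 3 * hc x (-1) - 1 / 6 * hc x 2
    have h2 (x : J) : l₂ (traceAdj τ x) = 0 := by
      linear_combination 1 / 2 * hc x 1 + 1 / 2 * hc x (-1) - hc x 0
    have h3 : l₃ 1 = 0 := by
      have := hc 1 1
      rw [h0, h1, h2, hτ.norm_one] at this
      linear_combination this
    have h2one : l₂ 1 = 0 := by
      have := h2 1
      rwa [hτ.adj_one] at this
    -- The adjoints span `J`: the polarization satisfies `e × y = τ(y) e - y`.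
    have h2' (y : J) : l₂ y = 0 := by
      have := h2 (1 + y)
      rw [traceAdj_add, map_add, map_add, h2, h2, traceCross, hτ.map_one] at this
      simp only [one_mul, map_add, map_sub, map_smul, smul_eq_mul, h2one] at this
      linear_combination -this
    refine hl0 (LinearMap.ext fun v => ?_)
    obtain ⟨s, x, y, t⟩ := v
    rw [hsplit, h0, h1, h2', h3]
    simp
  rw [IsNondegenerate, ← Projectivization.Subspace.submodule.injective.eq_iff,
    Projectivization.Subspace.submodule.map_top, eq_top_iff, ← hspan, Submodule.span_le]
  rintro _ ⟨x, rfl⟩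
  rw [SetLike.mem_coe, Projectivization.Subspace.mem_submodule_iff _ (zornPoint_ne_zero τ x)]
  exact Projectivization.Subspace.subset_span _ (zornMap_mem_traceVariety τ x)

variable [FiniteDimensional ℂ J]

lemma isPolyMap_zornPoint (τ : Module.Dual ℂ J) : IsPolyMap (zornPoint τ) :=
  (isPolyMap_const 1).prodMk (LinearMap.id.isPolyMap.prodMk
    ((isPolyMap_traceAdj τ).prodMk (mem_polyFun.isPolyMap (traceNorm_mem_polyFun τ))))

lemma continuous_zornMap (τ : Module.Dual ℂ J) :
    @Continuous _ _ (affineZariski J) (projZariski (ZornMatrices J)) (zornMap τ) :=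
  continuous_mk_of_isPolyMap (isPolyMap_zornPoint τ) (zornPoint_ne_zero τ)

lemma isProjVariety_traceVariety (τ : Module.Dual ℂ J) : IsProjVariety (traceVariety τ) := by
  let := projZariski (ZornMatrices J)
  let := affineZariski J
  refine ⟨isClosed_closure, ?_⟩
  have h := isIrreducible_submodule (⊤ : Submodule ℂ J)
  rw [Submodule.top_coe] at h
  have := (h.image _ (continuous_zornMap τ).continuousOn).closure
  rwa [Set.image_univ] at this

/-- The cone over the image of `ν` is parametrized by `ℂ × J`, which gives the upper bound; the
second entry of `ν(x)` recovers `x`, which gives the lower one. -/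
lemma projDim_traceVariety (τ : Module.Dual ℂ J) :
    projDim (traceVariety τ) = Module.finrank ℂ J := by
  apply le_antisymm
  · have hF : IsPolyMap fun w : ℂ × J => w.1 • zornPoint τ w.2 :=
      .smul (dual_mem_polyFun (LinearMap.fst ℂ ℂ J))
        ((isPolyMap_zornPoint τ).comp (LinearMap.snd ℂ ℂ J).isPolyMap)
    refine projDim_le_of_isPolyMap hF (by rw [Module.finrank_prod]; simp [add_comm]) ?_
    intro f hf hf0 p hp c
    refine eq_zero_of_mem_closure hf ?_ hp c
    rintro _ ⟨x, rfl⟩ c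
    obtain ⟨e, -, he⟩ := exists_mk_rep_eq_smul (zornPoint_ne_zero τ x)
    rw [zornMap, he, smul_smul]
    exact hf0 (c * e, x)
  · refine finrank_le_projDim (continuous_zornMap τ) (zornMap_mem_traceVariety τ) fun l => ?_
    let L : Module.Dual ℂ (ZornMatrices J) := l ∘ₗ LinearMap.fst ℂ J (J × ℂ) ∘ₗ
      LinearMap.snd ℂ ℂ (J × J × ℂ)
    refine ⟨_, isClosed_homogeneous_eq_zero (isHomogeneousPoly_dual L), fun x => ?_⟩
    exact (isHomogeneousPoly_dual L).mk_rep_eq_zero_iff _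

/-- The points of the trace variety outside the hyperplane `s = 0` are the points of its
parametrization. -/
lemma rep_eq_smul_zornPoint {τ : Module.Dual ℂ J} {p : ℙ ℂ (ZornMatrices J)}
    (hp : p ∈ traceVariety τ) (h0 : p.rep.1 ≠ 0) : ∃ x, p.rep = p.rep.1 • zornPoint τ x := by
  rw [mem_traceVariety_iff] at hp
  have hs : IsHomogeneousPoly 1 fun v : ZornMatrices J => v.1 :=
    isHomogeneousPoly_dual (LinearMap.fst ℂ ℂ (J × J × ℂ))
  have ht : IsHomogeneousPoly 1 fun v : ZornMatrices J => v.2.2.2 :=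
    isHomogeneousPoly_dual (LinearMap.snd ℂ J ℂ ∘ₗ LinearMap.snd ℂ J (J × ℂ) ∘ₗ
      LinearMap.snd ℂ ℂ (J × J × ℂ))
  let X : ZornMatrices J →ₗ[ℂ] J := LinearMap.fst ℂ J (J × ℂ) ∘ₗ LinearMap.snd ℂ ℂ (J × J × ℂ)
  let Y : ZornMatrices J →ₗ[ℂ] J :=
    LinearMap.fst ℂ J ℂ ∘ₗ LinearMap.snd ℂ J (J × ℂ) ∘ₗ LinearMap.snd ℂ ℂ (J × J × ℂ)
  have hadj (l : Module.Dual ℂ J) : IsHomogeneousPoly 2 fun v : ZornMatrices J =>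
      l (traceAdj τ (X v)) :=
    ⟨(isPolyMap_traceAdj τ).comp X.isPolyMap l, fun c v => by
      beta_reduce
      rw [map_smul, traceAdj_smul, map_smul, smul_eq_mul]⟩
  have hnorm : IsHomogeneousPoly 3 fun v : ZornMatrices J => traceNorm τ (X v) :=
    ⟨comp_mem_polyFun X.isPolyMap (traceNorm_mem_polyFun τ), fun c v => by
      beta_reduce
      rw [map_smul, traceNorm_smul]⟩
  set v := p.rep with hv
  -- The homogeneous equations `s y = x^#` and `s ^ 2 t = N(x)` hold on the image of `ν`, hence on
  -- its closure; where `s ≠ 0` they determine `y` and `t`.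
  have h1 : v.1 • Y v = traceAdj τ (X v) := by
    rw [← sub_eq_zero, ← Module.forall_dual_apply_eq_zero_iff ℂ]
    intro l
    have := hp 2 _ ((hs.mul (isHomogeneousPoly_dual (l ∘ₗ Y))).sub (hadj l)) fun x => by
      simp [zornPoint, X, Y]
    simpa using this
  have h2 : v.1 ^ 2 * v.2.2.2 = traceNorm τ (X v) := by
    have := hp 3 _ (((hs.mul hs).mul ht).sub hnorm) fun x => by simp [zornPoint, X]
    linear_combination this
  refine ⟨v.1⁻¹ • X v, Prod.ext ?_ (Prod.ext ?_ (Prod.ext ?_ ?_))⟩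
  · simp [zornPoint]
  · simp [zornPoint, smul_smul, h0, X]
  · simp only [zornPoint, traceAdj_smul, ← h1, Prod.smul_snd, Prod.smul_fst, smul_smul]
    rw [show v.1 * (v.1⁻¹ ^ 2 * v.1) = 1 by field_simp, one_smul]
    rfl
  · simp only [zornPoint, traceNorm_smul, ← h2, Prod.smul_snd, smul_eq_mul]
    field_simp

end TraceVariety

/-! ### Jordan inversion and the twisted cubic through three points. -/

section Inverse

variable {J : Type*} [NonAssocCommRing J] [Module ℂ J]

/-- The Jordan inverse `N(x)⁻¹ x^#`. -/
def traceInv (τ : Module.Dual ℂ J) (x : J) : J := (traceNorm τ x)⁻¹ • traceAdj τ x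

variable {τ : Module.Dual ℂ J}

lemma traceNorm_zero : traceNorm τ 0 = 0 := by simp [traceNorm]

/-- The linear map whose composite with the twisted cubic curve parametrizes the points attached
to the line `a + t d`. -/
def zornLine (τ : Module.Dual ℂ J) (a d : J) : (Fin (3 + 1) → ℂ) →ₗ[ℂ] ZornMatrices J :=
  (LinearMap.proj 0).smulRight (zornPoint τ a) +
    (LinearMap.proj 1).smulRight (0, d, traceCross τ a d, τ (traceAdj τ a * d)) +
    (LinearMap.proj 2).smulRight (0, 0, traceAdj τ d, τ (a * traceAdj τ d)) +
    (LinearMap.proj 3).smulRight (0, 0, 0, traceNorm τ d)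

lemma zornLine_apply (a d : J) (c : Fin (3 + 1) → ℂ) : zornLine τ a d c =
    (c 0, c 0 • a + c 1 • d, c 0 • traceAdj τ a + c 1 • traceCross τ a d + c 2 • traceAdj τ d,
      c 0 * traceNorm τ a + c 1 * τ (traceAdj τ a * d) + c 2 * τ (a * traceAdj τ d) +
        c 3 * traceNorm τ d) := by
  simp [zornLine, zornPoint]

/-- The system is triangular with "diagonal" `1, d, d^#, N(d)`, all non-zero when `N(d) ≠ 0`. -/
lemma IsCubicTrace.zornLine_injective (hτ : IsCubicTrace τ) (a : J) {d : J}
    (hd : traceNorm τ d ≠ 0) : Function.Injective (zornLine τ a d) := by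
  rw [← LinearMap.ker_eq_bot, LinearMap.ker_eq_bot']
  intro c h
  rw [zornLine_apply] at h
  simp only [Prod.mk_eq_zero] at h
  obtain ⟨h0, h1, h2, h3⟩ := h
  rw [h0, zero_smul, zero_add, smul_eq_zero,
    or_iff_left (ne_zero_of_traceNorm_ne_zero hd)] at h1
  rw [h0, h1, zero_smul, zero_smul, zero_add, zero_add, smul_eq_zero,
    or_iff_left (hτ.adj_ne_zero hd)] at h2
  rw [h0, h1, h2, zero_mul, zero_mul, zero_mul, zero_add, zero_add, zero_add, mul_eq_zero,
    or_iff_left hd] at h3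
  ext i
  fin_cases i <;> assumption

/-- The point at infinity of the line; `inverseTranslation_last` sends it to the point of `x₀`. -/
lemma zornLine_cubic_zero (a d : J) (β : ℂ) :
    zornLine τ a d (fun i => (0 : ℂ) ^ (3 - (i : ℕ)) * β ^ (i : ℕ)) =
      (0, 0, 0, β ^ 3 * traceNorm τ d) := by
  rw [zornLine_apply]
  simp

variable [SMulCommClass ℂ J J]

/-- The linear automorphism of the space of Zorn matrices that corresponds to the birational map
`w ↦ x₀ + w⁻¹`. -/
def inverseTranslation (τ : Module.Dual ℂ J) (x₀ : J) : ZornMatrices J →ₗ[ℂ] ZornMatrices J where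
  toFun v := (v.2.2.2, v.2.2.1 + v.2.2.2 • x₀,
    v.2.1 + traceCross τ x₀ v.2.2.1 + v.2.2.2 • traceAdj τ x₀,
    v.1 + τ (x₀ * v.2.1) + τ (traceAdj τ x₀ * v.2.2.1) + v.2.2.2 * traceNorm τ x₀)
  map_add' v w := by
    refine Prod.ext rfl (Prod.ext ?_ (Prod.ext ?_ ?_))
    · simp only [Prod.snd_add, Prod.fst_add]
      module
    · simp only [Prod.snd_add, Prod.fst_add, traceCross, mul_add, map_add]
      module
    · simp only [Prod.snd_add, Prod.fst_add, mul_add, map_add]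
      ring
  map_smul' c v := by
    refine Prod.ext rfl (Prod.ext ?_ (Prod.ext ?_ ?_))
    · simp only [Prod.smul_snd, Prod.smul_fst, RingHom.id_apply, smul_eq_mul]
      module
    · simp only [Prod.smul_snd, Prod.smul_fst, RingHom.id_apply, smul_eq_mul, traceCross,
        mul_smul_comm, map_smul]
      module
    · simp only [Prod.smul_snd, Prod.smul_fst, RingHom.id_apply, smul_eq_mul, mul_smul_comm,
        map_smul]
      ring

lemma inverseTranslation_apply (x₀ : J) (s : ℂ) (x y : J) (t : ℂ) :
    inverseTranslation τ x₀ (s, x, y, t) = (t, y + t • x₀,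
      x + traceCross τ x₀ y + t • traceAdj τ x₀,
      s + τ (x₀ * x) + τ (traceAdj τ x₀ * y) + t * traceNorm τ x₀) := rfl

lemma inverseTranslation_injective (x₀ : J) : Function.Injective (inverseTranslation τ x₀) := by
  rw [← LinearMap.ker_eq_bot, LinearMap.ker_eq_bot']
  rintro ⟨s, x, y, t⟩ h
  rw [inverseTranslation_apply] at h
  simp only [Prod.mk_eq_zero] at h
  obtain ⟨rfl, h1, h2, h3⟩ := h
  rw [zero_smul, add_zero] at h1
  subst h1
  have hx : x = 0 := by simpa [traceCross] using h2
  subst hx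
  simpa using h3

lemma inverseTranslation_last (x₀ : J) (t : ℂ) :
    inverseTranslation τ x₀ (0, 0, 0, t) = t • zornPoint τ x₀ := by
  rw [inverseTranslation_apply]
  simp [zornPoint, traceCross]

variable [IsScalarTower ℂ J J]

namespace IsCubicTrace

/-- No hypothesis on `N(x)` is needed: if it vanishes, both sides are zero by the convention `0⁻¹ =
0`. -/
lemma norm_inv (hτ : IsCubicTrace τ) (x : J) : traceNorm τ (traceInv τ x) = (traceNorm τ x)⁻¹ := by
  by_cases hx : traceNorm τ x = 0
  · simp [traceInv, hx, traceNorm_zero]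
  · rw [traceInv, traceNorm_smul, hτ.norm_adj]
    field_simp

lemma adj_inv (hτ : IsCubicTrace τ) (x : J) :
    traceAdj τ (traceInv τ x) = (traceNorm τ x)⁻¹ • x := by
  by_cases hx : traceNorm τ x = 0
  · simp [traceInv, hx, traceAdj_zero]
  · rw [traceInv, traceAdj_smul, hτ.adj_adj, smul_smul]
    congr 1
    field_simp

lemma inv_inv (hτ : IsCubicTrace τ) {x : J} (hx : traceNorm τ x ≠ 0) :
    traceInv τ (traceInv τ x) = x := by
  rw [traceInv, hτ.adj_inv, hτ.norm_inv, smul_smul, _root_.inv_inv, mul_inv_cancel₀ hx, one_smul]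

end IsCubicTrace

/-- Since `w^# = N(w) w⁻¹` and `w = N(w) (w⁻¹)^#`, inversion reverses the entries up to the factor
`N(w)`; the terms in `x₀` are those of the addition formulas for `^#` and `N`. -/
lemma IsCubicTrace.inverseTranslation_zornPoint (hτ : IsCubicTrace τ) (x₀ : J) {w : J}
    (hw : traceNorm τ w ≠ 0) : inverseTranslation τ x₀ (zornPoint τ w) =
      traceNorm τ w • zornPoint τ (x₀ + traceInv τ w) := by
  have h1 : traceAdj τ w = traceNorm τ w • traceInv τ w := by
    rw [traceInv, smul_smul, mul_inv_cancel₀ hw, one_smul]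
  have h2 : traceNorm τ w • traceAdj τ (traceInv τ w) = w := by
    rw [hτ.adj_inv, smul_smul, mul_inv_cancel₀ hw, one_smul]
  have hcross : traceCross τ x₀ (traceNorm τ w • traceInv τ w) =
      traceNorm τ w • traceCross τ x₀ (traceInv τ w) := by
    simp only [traceCross, mul_smul_comm, map_smul, smul_eq_mul]
    module
  rw [zornPoint, inverseTranslation_apply, zornPoint, traceAdj_add, hτ.norm_add, h1]
  refine Prod.ext ?_ (Prod.ext ?_ (Prod.ext ?_ ?_))
  · simp
  · simp [add_comm]
  · simp only [hcross, Prod.smul_snd, Prod.smul_fst, smul_add, h2]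
    abel
  · have h3 : τ (x₀ * w) = traceNorm τ w * τ (x₀ * traceAdj τ (traceInv τ w)) := by
      conv_lhs => rw [← h2, mul_smul_comm, map_smul, smul_eq_mul]
    have h4 : traceNorm τ w * traceNorm τ (traceInv τ w) = 1 := by
      rw [hτ.norm_inv, mul_inv_cancel₀ hw]
    simp only [Prod.smul_snd, smul_eq_mul, mul_smul_comm, map_smul, h3]
    linear_combination -h4

/-- A homogeneous polynomial vanishing on the trace variety vanishes on its image under an
inverse translation. -/
lemma IsCubicTrace.eq_zero_inverseTranslation [FiniteDimensional ℂ J] (hτ : IsCubicTrace τ)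
    (x₀ : J) {d : ℕ} {f : ZornMatrices J → ℂ} (hf : IsHomogeneousPoly d f)
    (h : ∀ x, f (zornPoint τ x) = 0) (w : J) : f (inverseTranslation τ x₀ (zornPoint τ w)) = 0 := by
  -- The formula for the image is available where `N(w) ≠ 0`, a non-empty set as `N(e) = 1`;
  -- vanishing there extends to all `w`.
  refine eq_zero_of_forGeneral (comp_mem_polyFun
    ((inverseTranslation τ x₀).isPolyMap.comp (isPolyMap_zornPoint τ)) hf.1)
    ((forGeneral_ne_zero (traceNorm_mem_polyFun τ) ⟨1, ?_⟩).mono fun w hw => ?_) w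
  · rw [hτ.norm_one]
    exact _root_.one_ne_zero
  · rw [hτ.inverseTranslation_zornPoint x₀ hw, hf.2, h, mul_zero]

/-- Homogenization, with `t = β / α`, of the addition formulas along `a + t d`. -/
lemma IsCubicTrace.zornLine_cubic (hτ : IsCubicTrace τ) (a d : J) {α : ℂ} (hα : α ≠ 0) (β : ℂ) :
    zornLine τ a d (fun i => α ^ (3 - (i : ℕ)) * β ^ (i : ℕ)) =
      α ^ 3 • zornPoint τ (a + (β / α) • d) := by
  have hcross : traceCross τ a ((β / α) • d) = (β / α) • traceCross τ a d := by
    simp only [traceCross, mul_smul_comm, map_smul, smul_eq_mul]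
    module
  rw [zornLine_apply, zornPoint, traceAdj_add, hτ.norm_add, hcross, traceAdj_smul, traceNorm_smul]
  refine Prod.ext ?_ (Prod.ext ?_ (Prod.ext ?_ ?_))
  · simp
  · simp only [Prod.smul_snd, Prod.smul_fst, smul_add, smul_smul]
    congr 2
    all_goals simp
    all_goals field_simp
  · simp only [Prod.smul_snd, Prod.smul_fst, smul_add, smul_smul]
    congr 2
    all_goals simp
    all_goals field_simp
  · simp only [Prod.smul_snd, smul_eq_mul, mul_smul_comm, map_smul]
    simp
    field_simp

/-- The map `w ↦ x₀ + w⁻¹` takes `∞, a, b` to `x₀, x₁, x₂`, so the curve is the image of the line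
joining `a` to `b`; the three points have parameters `[0 : 1]`, `[1 : 0]`, `[1 : 1]`. -/
lemma IsCubicTrace.exists_rationalNormalCurve [FiniteDimensional ℂ J] (hτ : IsCubicTrace τ)
    {p : Fin 3 → ℙ ℂ (ZornMatrices J)} {x : Fin 3 → J} {s : Fin 3 → ℂ} (hs : ∀ i, s i ≠ 0)
    (hp : ∀ i, (p i).rep = s i • zornPoint τ (x i))
    (h1 : traceNorm τ (x 1 - x 0) ≠ 0) (h2 : traceNorm τ (x 2 - x 0) ≠ 0)
    (h3 : traceNorm τ (traceInv τ (x 2 - x 0) - traceInv τ (x 1 - x 0)) ≠ 0) :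
    ∃ C : Set (ℙ ℂ (ZornMatrices J)), IsRationalNormalCurve 3 C ∧ C ⊆ traceVariety τ ∧
      ∀ i, p i ∈ C := by
  set a := traceInv τ (x 1 - x 0) with ha
  set b := traceInv τ (x 2 - x 0) with hb
  have hsub (i : Fin 3) : (p i).submodule = Submodule.span ℂ {zornPoint τ (x i)} := by
    rw [Projectivization.submodule_eq, hp, Submodule.span_singleton_smul_eq (hs i).isUnit]
  have hmem (i : Fin 3) (u : J) (hu : traceNorm τ (traceInv τ u) ≠ 0) (hxu : x i = x 0 + u)
      (hu' : traceNorm τ u ≠ 0) : (p i).submodule =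
      Submodule.span ℂ {inverseTranslation τ (x 0) (zornPoint τ (traceInv τ u))} := by
    rw [hsub, hτ.inverseTranslation_zornPoint _ hu, Submodule.span_singleton_smul_eq hu.isUnit,
      hτ.inv_inv hu', hxu]
  have hinv {u : J} (hu : traceNorm τ u ≠ 0) : traceNorm τ (traceInv τ u) ≠ 0 := by
    rw [hτ.norm_inv]
    exact inv_ne_zero hu
  refine ⟨_, ⟨inverseTranslation τ (x 0) ∘ₗ zornLine τ a (b - a),
    (inverseTranslation_injective _).comp (hτ.zornLine_injective a h3), rfl⟩, ?_, ?_⟩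
  · rintro q ⟨α, β, -, hq⟩
    rw [mem_traceVariety_iff]
    intro d f hf hf0
    obtain ⟨c, hc, hqc⟩ := exists_rep_eq_smul hq
    rw [hqc, hf.smul_eq_zero_iff hc, LinearMap.comp_apply]
    by_cases hα : α = 0
    · rw [hα, zornLine_cubic_zero, inverseTranslation_last, hf.2, hf0, mul_zero]
    · rw [hτ.zornLine_cubic _ _ hα, map_smul, hf.2, hτ.eq_zero_inverseTranslation _ hf hf0,
        mul_zero]
  · intro i
    fin_cases i
    · refine ⟨0, 1, Or.inr _root_.one_ne_zero, ?_⟩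
      rw [LinearMap.comp_apply, zornLine_cubic_zero, inverseTranslation_last, one_pow, one_mul,
        Submodule.span_singleton_smul_eq h3.isUnit]
      exact hsub 0
    · refine ⟨1, 0, Or.inl _root_.one_ne_zero, ?_⟩
      rw [LinearMap.comp_apply, hτ.zornLine_cubic _ _ _root_.one_ne_zero, one_pow, one_smul, zero_div,
        zero_smul, add_zero]
      exact hmem 1 _ (hinv h1) (by abel) h1
    · refine ⟨1, 1, Or.inl _root_.one_ne_zero, ?_⟩
      rw [LinearMap.comp_apply, hτ.zornLine_cubic _ _ _root_.one_ne_zero, one_pow, one_smul, div_one,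
        one_smul, add_sub_cancel]
      exact hmem 2 _ (hinv h2) (by abel) h2

end Inverse

/-! ### General triples of points. -/

section Covering

variable {J : Type*} [NonAssocCommRing J] [Module ℂ J]

/-- The polynomial whose non-vanishing defines the triples of points in general position. -/
def generalTriple (τ : Module.Dual ℂ J) (v : Fin 3 → ZornMatrices J) : ℂ :=
  (v 0).1 * (v 1).1 * (v 2).1 *
    traceNorm τ ((v 0).1 • (v 1).2.1 - (v 1).1 • (v 0).2.1) *
    traceNorm τ ((v 0).1 • (v 2).2.1 - (v 2).1 • (v 0).2.1) *
    traceNorm τ (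
      ((v 2).1 * traceNorm τ ((v 0).1 • (v 1).2.1 - (v 1).1 • (v 0).2.1)) •
        traceAdj τ ((v 0).1 • (v 2).2.1 - (v 2).1 • (v 0).2.1) -
      ((v 1).1 * traceNorm τ ((v 0).1 • (v 2).2.1 - (v 2).1 • (v 0).2.1)) •
        traceAdj τ ((v 0).1 • (v 1).2.1 - (v 1).1 • (v 0).2.1))

variable {τ : Module.Dual ℂ J}

lemma generalTriple_zornPoint (x : Fin 3 → J) :
    generalTriple τ (fun i => zornPoint τ (x i)) =
      traceNorm τ (x 1 - x 0) * traceNorm τ (x 2 - x 0) *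
        traceNorm τ (traceNorm τ (x 1 - x 0) • traceAdj τ (x 2 - x 0) -
          traceNorm τ (x 2 - x 0) • traceAdj τ (x 1 - x 0)) := by
  simp [generalTriple, zornPoint]

variable [SMulCommClass ℂ J J] [IsScalarTower ℂ J J]

/-- The last norm is taken at an element of multidegree `(5, 3, 3)`, so the degrees are `22 = 1 + 3
+ 3 + 15` and `13 = 1 + 3 + 9`. -/
lemma generalTriple_smul (c : Fin 3 → ℂ) (v : Fin 3 → ZornMatrices J) :
    generalTriple τ (fun i => c i • v i) = (∏ i, c i ^ (![22, 13, 13] : Fin 3 → ℕ) i) *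
      generalTriple τ v := by
  have hu (i : Fin 3) : (c 0 • v 0).1 • (c i • v i).2.1 - (c i • v i).1 • (c 0 • v 0).2.1 =
      (c 0 * c i) • ((v 0).1 • (v i).2.1 - (v i).1 • (v 0).2.1) := by
    simp only [Prod.smul_snd, Prod.smul_fst, smul_eq_mul]
    module
  have hw (n₁ n₂ : ℂ) (u₁ u₂ : J) :
      ((c 2 • v 2).1 * ((c 0 * c 1) ^ 3 * n₁)) • (c 0 * c 2) ^ 2 • u₂ -
        ((c 1 • v 1).1 * ((c 0 * c 2) ^ 3 * n₂)) • (c 0 * c 1) ^ 2 • u₁ =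
      (c 0 ^ 5 * c 1 ^ 3 * c 2 ^ 3) • (((v 2).1 * n₁) • u₂ - ((v 1).1 * n₂) • u₁) := by
    simp only [Prod.smul_fst, smul_eq_mul]
    module
  simp only [generalTriple, hu, traceNorm_smul, traceAdj_smul, hw]
  simp only [Prod.smul_fst, smul_eq_mul, Fin.prod_univ_three]
  simp
  ring

variable [FiniteDimensional ℂ J]

lemma isMultihomogeneousPoly_generalTriple (τ : Module.Dual ℂ J) :
    IsMultihomogeneousPoly ![22, 13, 13] (generalTriple τ) := by
  refine ⟨?_, generalTriple_smul⟩
  have hs (i : Fin 3) : (fun v : Fin 3 → ZornMatrices J => (v i).1) ∈ polyFun _ :=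
    dual_mem_polyFun (LinearMap.fst ℂ ℂ (J × J × ℂ) ∘ₗ
      LinearMap.proj (R := ℂ) (φ := fun _ => ZornMatrices J) i)
  have hX (i : Fin 3) : IsPolyMap fun v : Fin 3 → ZornMatrices J => (v i).2.1 :=
    (LinearMap.fst ℂ J (J × ℂ) ∘ₗ LinearMap.snd ℂ ℂ (J × J × ℂ) ∘ₗ
      LinearMap.proj (R := ℂ) (φ := fun _ => ZornMatrices J) i).isPolyMap
  have hu (i : Fin 3) : IsPolyMap fun v : Fin 3 → ZornMatrices J =>
      (v 0).1 • (v i).2.1 - (v i).1 • (v 0).2.1 :=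
    (IsPolyMap.smul (hs 0) (hX i)).sub (.smul (hs i) (hX 0))
  have hN (i : Fin 3) := comp_mem_polyFun (hu i) (traceNorm_mem_polyFun τ)
  have hA (i : Fin 3) := (isPolyMap_traceAdj τ).comp (hu i)
  have hw := comp_mem_polyFun ((IsPolyMap.smul (mul_mem_polyFun (hs 2) (hN 1)) (hA 2)).sub
    (.smul (mul_mem_polyFun (hs 1) (hN 2)) (hA 1))) (traceNorm_mem_polyFun τ)
  exact mul_mem_polyFun (mul_mem_polyFun (mul_mem_polyFun (mul_mem_polyFun
    (mul_mem_polyFun (hs 0) (hs 1)) (hs 2)) (hN 1)) (hN 2)) hw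

/-- Through three general points of the trace variety there passes a twisted cubic curve contained
in the variety. -/
theorem IsCubicTrace.isCoveredBy (hτ : IsCubicTrace τ) :
    IsCoveredBy 3 (IsRationalNormalCurve 3) (traceVariety τ) := by
  have hmult := isMultihomogeneousPoly_generalTriple τ
  refine ⟨_, .basic _ ⟨_, _, hmult, rfl⟩, ⟨fun i => zornMap τ ((![0, 1, 2] : Fin 3 → ℂ) i • 1), ?_,
    fun i => zornMap_mem_traceVariety τ _⟩, fun p hp hpX => ?_⟩
  · have h (i : Fin 3) := exists_mk_rep_eq_smul 
      (zornPoint_ne_zero τ ((![0, 1, 2] : Fin 3 → ℂ) i • (1 : J)))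
    choose c hc hrep using h
    change generalTriple τ (fun i =>
      (zornMap τ ((![0, 1, 2] : Fin 3 → ℂ) i • 1)).rep) ≠ 0
    simp only [zornMap, hrep]
    rw [hmult.2, generalTriple_zornPoint]
    refine mul_ne_zero (Finset.prod_ne_zero_iff.2 fun i _ => pow_ne_zero _ (hc i)) ?_
    -- The triple `0, e, 2e` is general: the norms are `N(e) = 1`, `N(2e) = 8` and `N(4e - 8e) =
    -- -64`.
    have h1 : (![0, 1, 2] : Fin 3 → ℂ) 1 • (1 : J) - (![0, 1, 2] : Fin 3 → ℂ) 0 • (1 : J) =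
        (1 : ℂ) • 1 := by simp
    have h2 : (![0, 1, 2] : Fin 3 → ℂ) 2 • (1 : J) - (![0, 1, 2] : Fin 3 → ℂ) 0 • (1 : J) =
        (2 : ℂ) • 1 := by simp
    rw [h1, h2]
    simp only [traceNorm_smul, traceAdj_smul, hτ.norm_one, hτ.adj_one, smul_smul, ← sub_smul]
    norm_num
  · change generalTriple τ (fun i => (p i).rep) ≠ 0 at hp
    have hs (i : Fin 3) : (p i).rep.1 ≠ 0 := by
      intro h
      apply hp
      fin_cases i <;> simp_all [generalTriple]
    choose x hx using fun i => rep_eq_smul_zornPoint (hpX i) (hs i)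
    rw [show (fun i => (p i).rep) = fun i => (p i).rep.1 • zornPoint τ (x i) from funext hx,
      hmult.2, generalTriple_zornPoint] at hp
    have hp' := right_ne_zero_of_mul hp
    have h1 := left_ne_zero_of_mul (left_ne_zero_of_mul hp')
    have h2 := right_ne_zero_of_mul (left_ne_zero_of_mul hp')
    have h3 := right_ne_zero_of_mul hp'
    refine hτ.exists_rationalNormalCurve hs hx h1 h2 fun h => h3 ?_
    -- The last factor of `generalTriple` is the norm of the difference of the inverses, cleared of
    -- denominators.
    have : traceNorm τ (x 1 - x 0) • traceAdj τ (x 2 - x 0) -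
        traceNorm τ (x 2 - x 0) • traceAdj τ (x 1 - x 0) =
        (traceNorm τ (x 1 - x 0) * traceNorm τ (x 2 - x 0)) •
          (traceInv τ (x 2 - x 0) - traceInv τ (x 1 - x 0)) := by
      rw [traceInv, traceInv, smul_sub, smul_smul, smul_smul]
      congr 2 <;> field_simp
    rw [this, traceNorm_smul, h, mul_zero]

end Covering

/-! ### Twisted cubic curves are irreducible curves of degree three. -/

section RationalNormalCubic

variable {V : Type*} [AddCommGroup V] [Module ℂ V]

/-- The affine cone over the standard twisted cubic curve. -/
def cubicCurve (w : ℂ × ℂ) : Fin (3 + 1) → ℂ := fun i => w.1 ^ (3 - (i : ℕ)) * w.2 ^ (i : ℕ)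

lemma isPolyMap_cubicCurve : IsPolyMap cubicCurve := by
  intro l
  have h : (fun w => l (cubicCurve w)) = fun w => ∑ i, cubicCurve w i * l (Pi.single i 1) := by
    funext w
    conv_lhs => rw [pi_eq_sum_univ' (cubicCurve w)]
    simp
  rw [h]
  exact sum_mem_polyFun _ fun i _ => mul_mem_polyFun (mul_mem_polyFun
    (pow_mem_polyFun (dual_mem_polyFun (LinearMap.fst ℂ ℂ ℂ)) _)
    (pow_mem_polyFun (dual_mem_polyFun (LinearMap.snd ℂ ℂ ℂ)) _)) (const_mem_polyFun _)

lemma cubicCurve_smul (c : ℂ) (w : ℂ × ℂ) : cubicCurve (c • w) = c ^ 3 • cubicCurve w := by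
  ext i
  have : c ^ 3 = c ^ (3 - (i : ℕ)) * c ^ (i : ℕ) := by
    rw [← pow_add]
    congr 1
    omega
  simp only [cubicCurve, Prod.smul_fst, Prod.smul_snd, smul_eq_mul, Pi.smul_apply, this]
  ring

lemma cubicCurve_eq_smul {w : ℂ × ℂ} (h : w.1 ≠ 0) :
    cubicCurve w = w.1 ^ 3 • cubicCurve (1, w.2 / w.1) := by
  rw [← cubicCurve_smul]
  congr 1
  ext
  · simp
  · simp [mul_div_cancel₀ _ h]

lemma cubicCurve_ne_zero {w : ℂ × ℂ} (hw : w ≠ 0) : cubicCurve w ≠ 0 := by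
  intro h
  apply hw
  have h0 := congrFun h 0
  have h3 := congrFun h 3
  ext
  · simpa [cubicCurve] using h0
  · simpa [cubicCurve] using h3

/-- If `y 0 ≠ 0` the parameter is `y 1 / y 0`; if `y 0 = 0` the minors force `y 1 = y 2 = 0`,
leaving the point `[0 : 1]`. -/
lemma exists_eq_smul_cubicCurve {y : Fin (3 + 1) → ℂ} (hy : y ≠ 0) (h1 : y 0 * y 2 = y 1 * y 1)
    (h2 : y 1 * y 3 = y 2 * y 2) (h3 : y 0 * y 3 = y 1 * y 2) :
    ∃ (c : ℂ) (w : ℂ × ℂ), w ≠ 0 ∧ c ≠ 0 ∧ y = c • cubicCurve w := by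
  by_cases h0 : y 0 = 0
  · have hy1 : y 1 = 0 := by simpa [h0] using h1.symm
    have hy2 : y 2 = 0 := by simpa [hy1] using h2.symm
    refine ⟨y 3, (0, 1), by simp, fun hy3 => hy ?_, ?_⟩
    · ext i
      fin_cases i <;> assumption
    · ext i
      fin_cases i <;> simp [cubicCurve, h0, hy1, hy2]
  · refine ⟨y 0, (1, y 1 / y 0), by simp, h0, ?_⟩
    ext i
    fin_cases i
    · simp [cubicCurve]
    · simp [cubicCurve, mul_div_cancel₀ _ h0]
    · simp only [cubicCurve, Pi.smul_apply, smul_eq_mul]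
      simp
      field_simp
      linear_combination h1
    · simp only [cubicCurve, Pi.smul_apply, smul_eq_mul]
      simp
      field_simp
      linear_combination y 0 * h3 + y 1 * h1

/-- The rational normal curve defined by a linear map. -/
def cubicImage (L : (Fin (3 + 1) → ℂ) →ₗ[ℂ] V) : Set (ℙ ℂ V) :=
  {p | ∃ a b : ℂ, (a ≠ 0 ∨ b ≠ 0) ∧
    p.submodule = Submodule.span ℂ {L fun i => a ^ (3 - (i : ℕ)) * b ^ (i : ℕ)}}

variable {L : (Fin (3 + 1) → ℂ) →ₗ[ℂ] V}

lemma mem_cubicImage_iff {p : ℙ ℂ V} : p ∈ cubicImage L ↔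
    ∃ (c : ℂ) (w : ℂ × ℂ), w ≠ 0 ∧ c ≠ 0 ∧ p.rep = c • L (cubicCurve w) := by
  constructor
  · rintro ⟨a, b, hab, h⟩
    obtain ⟨c, hc, hp⟩ := exists_rep_eq_smul h
    refine ⟨c, (a, b), ?_, hc, hp⟩
    rw [Ne, Prod.mk_eq_zero]
    tauto
  · rintro ⟨c, w, hw, hc, hp⟩
    refine ⟨w.1, w.2, ?_, ?_⟩
    · by_contra! h
      exact hw (Prod.ext h.1 h.2)
    · rw [Projectivization.submodule_eq, hp, Submodule.span_singleton_smul_eq hc.isUnit]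
      rfl

lemma map_cubicCurve_ne_zero (hL : Function.Injective L) {w : ℂ × ℂ} (hw : w ≠ 0) :
    L (cubicCurve w) ≠ 0 :=
  (map_ne_zero_iff L hL).2 (cubicCurve_ne_zero hw)

lemma mk_mem_cubicImage (hL : Function.Injective L) {w : ℂ × ℂ} (hw : w ≠ 0) :
    Projectivization.mk ℂ _ (map_cubicCurve_ne_zero hL hw) ∈ cubicImage L := by
  obtain ⟨c, hc, h⟩ := exists_mk_rep_eq_smul (map_cubicCurve_ne_zero hL hw)
  exact mem_cubicImage_iff.2 ⟨c, w, hw, hc, h⟩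

lemma isPolyMap_map_cubicCurve : IsPolyMap fun w => L (cubicCurve w) :=
  L.isPolyMap.comp isPolyMap_cubicCurve

/-- With a left inverse `M` of `L`, the equations are `v = L (M v)`, tested on linear forms, and the
three minors in `M v`. -/
lemma isClosed_cubicImage (hL : Function.Injective L) :
    IsClosed[projZariski V] (cubicImage L) := by
  let := projZariski V
  obtain ⟨M, hM⟩ := LinearMap.exists_leftInverse_of_injective L (LinearMap.ker_eq_bot.2 hL)
  have hy (i : Fin (3 + 1)) : IsHomogeneousPoly 1 fun v => M v i :=
    isHomogeneousPoly_dual (LinearMap.proj i ∘ₗ M)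
  have hmin (i j k l : Fin (3 + 1)) := isClosed_homogeneous_eq_zero
    (((hy i).mul (hy j)).sub ((hy k).mul (hy l)))
  have hlin (φ : Module.Dual ℂ V) := isClosed_homogeneous_eq_zero
    ((isHomogeneousPoly_dual φ).sub (isHomogeneousPoly_dual (φ ∘ₗ L ∘ₗ M)))
  convert (isClosed_iInter hlin).inter (((hmin 0 2 1 1).inter (hmin 1 3 2 2)).inter (hmin 0 3 1 2))
  ext p
  simp only [mem_cubicImage_iff, Set.mem_inter_iff, Set.mem_iInter, Set.mem_ofPred_eq, sub_eq_zero]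
  constructor
  · rintro ⟨c, w, -, -, hp⟩
    have hMp : M p.rep = c • cubicCurve w := by
      rw [hp, map_smul, ← LinearMap.comp_apply, hM, LinearMap.id_apply]
    rw [hMp]
    refine ⟨fun φ => ?_, ⟨?_, ?_⟩, ?_⟩
    · rw [LinearMap.comp_apply, LinearMap.comp_apply, hMp, map_smul L, ← hp]
    all_goals
      simp [cubicCurve]
      ring
  · rintro ⟨h, ⟨h1, h2⟩, h3⟩
    have hp : p.rep = L (M p.rep) := by
      rw [← sub_eq_zero, ← Module.forall_dual_apply_eq_zero_iff ℂ]
      intro φ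
      rw [map_sub, sub_eq_zero]
      exact h φ
    have h0 : M p.rep ≠ 0 := by
      intro h
      rw [h, map_zero] at hp
      exact p.rep_nonzero hp
    obtain ⟨c, w, hw, hc, hy⟩ := exists_eq_smul_cubicCurve h0 h1 h2 h3
    exact ⟨c, w, hw, hc, by rw [hp, hy, map_smul]⟩

lemma isIrreducible_cubicImage (hL : Function.Injective L) :
    @IsIrreducible _ (projZariski V) (cubicImage L) := by
  let := projZariski V
  refine ⟨⟨_, mk_mem_cubicImage hL (w := (1, 0)) (by simp)⟩, ?_⟩
  rintro U U' hU hU' ⟨p, hpC, hp⟩ ⟨q, hqC, hq⟩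
  obtain ⟨d, f, hf, hfp, hfU⟩ := isOpen_projZariski_iff hU hp
  obtain ⟨e, g, hg, hgq, hgU⟩ := isOpen_projZariski_iff hU' hq
  obtain ⟨c, w, hw, hc, hpw⟩ := mem_cubicImage_iff.1 hpC
  obtain ⟨c', w', hw', hc', hqw⟩ := mem_cubicImage_iff.1 hqC
  rw [hpw, Ne, hf.smul_eq_zero_iff hc] at hfp
  rw [hqw, Ne, hg.smul_eq_zero_iff hc'] at hgq
  have hfF := comp_mem_polyFun (isPolyMap_map_cubicCurve (L := L)) hf.1
  have hgF := comp_mem_polyFun (isPolyMap_map_cubicCurve (L := L)) hg.1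
  obtain ⟨z, hz⟩ := ((((forGeneral_ne_zero hfF ⟨w, hfp⟩).and (forGeneral_ne_zero hgF ⟨w', hgq⟩)).and
    (forGeneral_ne_zero (dual_mem_polyFun (LinearMap.fst ℂ ℂ ℂ)) ⟨(1, 0), by simp⟩))).exists
  have hz0 : z ≠ 0 := by
    rintro rfl
    exact hz.2 (map_zero _)
  exact ⟨_, mk_mem_cubicImage hL hz0, hfU _ ((hf.mk_rep_eq_zero_iff _).not.2 hz.1.1),
    hgU _ ((hg.mk_rep_eq_zero_iff _).not.2 hz.1.2)⟩

lemma projDim_cubicImage (hL : Function.Injective L) : projDim (cubicImage L) = 1 := by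
  apply le_antisymm
  · refine projDim_le_of_isPolyMap (m := 1) (isPolyMap_map_cubicCurve (L := L)) (by simp) ?_
    intro f hf hf0 p hp c
    obtain ⟨e, w, -, -, hpw⟩ := mem_cubicImage_iff.1 hp
    -- A cube root absorbs the scalar into the parameter, so `ℂ × ℂ` parametrizes the whole cone.
    obtain ⟨r, hr⟩ := IsAlgClosed.exists_pow_nat_eq (c * e) (n := 3) (by norm_num)
    rw [hpw, smul_smul, ← hr, ← map_smul, ← cubicCurve_smul]
    exact hf0 _
  · obtain ⟨M, hM⟩ := LinearMap.exists_leftInverse_of_injective L (LinearMap.ker_eq_bot.2 hL)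
    have hne (t : ℂ) : ((1, t) : ℂ × ℂ) ≠ 0 := by simp
    have hline : IsPolyMap fun t : ℂ => ((1, t) : ℂ × ℂ) :=
      (isPolyMap_const 1).prodMk LinearMap.id.isPolyMap
    have h := finrank_le_projDim (X := cubicImage L) (continuous_mk_of_isPolyMap
      (isPolyMap_map_cubicCurve.comp hline) fun t => map_cubicCurve_ne_zero hL (hne t))
      (fun t => mk_mem_cubicImage hL (hne t)) (fun l => by
        have hl := isHomogeneousPoly_dual (l ∘ₗ LinearMap.proj 1 ∘ₗ M)
        refine ⟨_, isClosed_homogeneous_eq_zero hl, fun t => (hl.mk_rep_eq_zero_iff _).trans ?_⟩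
        rw [LinearMap.comp_apply, LinearMap.comp_apply, ← LinearMap.comp_apply M, hM]
        simp [cubicCurve])
    simpa using h

/-- The restriction of a linear form to a twisted cubic curve. -/
def hyperplaneCubic (L : (Fin (3 + 1) → ℂ) →ₗ[ℂ] V) (l : Module.Dual ℂ V) : Cubic ℂ :=
  ⟨l (L (Pi.single 3 1)), l (L (Pi.single 2 1)), l (L (Pi.single 1 1)), l (L (Pi.single 0 1))⟩

lemma apply_cubicCurve (l : Module.Dual ℂ V) (w : ℂ × ℂ) :
    l (L (cubicCurve w)) = (hyperplaneCubic L l).d * w.1 ^ 3 +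
      (hyperplaneCubic L l).c * (w.1 ^ 2 * w.2) + (hyperplaneCubic L l).b * (w.1 * w.2 ^ 2) +
      (hyperplaneCubic L l).a * w.2 ^ 3 := by
  have : cubicCurve w = ∑ i, cubicCurve w i • Pi.single i (1 : ℂ) := by
    ext i
    simp [Finset.sum_apply, Pi.single_apply]
  rw [this]
  simp [Fin.sum_univ_four, cubicCurve, hyperplaneCubic]
  ring

lemma hyperplaneCubic_mem_polyFun :
    (fun l : Module.Dual ℂ V => (hyperplaneCubic L l).a * (hyperplaneCubic L l).discr) ∈
      polyFun (Module.Dual ℂ V) := by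
  have h (i : Fin (3 + 1)) : (fun l : Module.Dual ℂ V => l (L (Pi.single i 1))) ∈
      polyFun (Module.Dual ℂ V) := dual_mem_polyFun (Module.Dual.eval ℂ V (L (Pi.single i 1)))
  simp only [Cubic.discr, hyperplaneCubic]
  exact mul_mem_polyFun (h 3) (add_mem_polyFun (sub_mem_polyFun (sub_mem_polyFun (sub_mem_polyFun
    (mul_mem_polyFun (pow_mem_polyFun (h 2) 2) (pow_mem_polyFun (h 1) 2))
    (mul_mem_polyFun (mul_mem_polyFun (const_mem_polyFun 4) (h 3)) (pow_mem_polyFun (h 1) 3)))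
    (mul_mem_polyFun (mul_mem_polyFun (const_mem_polyFun 4) (pow_mem_polyFun (h 2) 3)) (h 0)))
    (mul_mem_polyFun (mul_mem_polyFun (const_mem_polyFun 27) (pow_mem_polyFun (h 3) 2))
      (pow_mem_polyFun (h 0) 2)))
    (mul_mem_polyFun (mul_mem_polyFun (mul_mem_polyFun (mul_mem_polyFun (const_mem_polyFun 18)
      (h 3)) (h 2)) (h 1)) (h 0)))

/-- A non-zero leading coefficient keeps `[0 : 1]` off the hyperplane, so the intersection is the
root set of a cubic in `t`; a non-zero discriminant makes its three roots distinct. -/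
lemma encard_cubicImage_inter (hL : Function.Injective L) {l : Module.Dual ℂ V}
    (ha : (hyperplaneCubic L l).a ≠ 0) (hd : (hyperplaneCubic L l).discr ≠ 0) :
    {p ∈ cubicImage L | l p.rep = 0}.encard = 3 := by
  classical
  set P := hyperplaneCubic L l
  have hne (t : ℂ) : ((1, t) : ℂ × ℂ) ≠ 0 := by simp
  let g : ℂ → ℙ ℂ V := fun t => Projectivization.mk ℂ _ (map_cubicCurve_ne_zero hL (hne t))
  have hg : Function.Injective g := by
    intro t t' h
    obtain ⟨c, hc⟩ := (Projectivization.mk_eq_mk_iff' ℂ _ _ _ _).1 h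
    rw [← map_smul] at hc
    have hc' := hL hc
    have h0 := congrFun hc' 0
    have h1 := congrFun hc' 1
    simp [cubicCurve] at h0 h1
    rw [h0, one_mul] at h1
    exact h1.symm
  have hP0 : P.toPoly ≠ 0 := Cubic.ne_zero_of_a_ne_zero ha
  have hset : {p ∈ cubicImage L | l p.rep = 0} = g '' (P.roots.toFinset : Set ℂ) := by
    ext p
    simp only [Set.mem_ofPred_eq, Set.mem_image, Finset.mem_coe, Multiset.mem_toFinset,
      Cubic.mem_roots_iff hP0]
    constructor
    · rintro ⟨hp, hl⟩
      obtain ⟨c, w, hw, hc, hpw⟩ := mem_cubicImage_iff.1 hp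
      rw [hpw, map_smul, smul_eq_mul, mul_eq_zero, or_iff_right hc, apply_cubicCurve] at hl
      have hw1 : w.1 ≠ 0 := by
        intro h
        rw [h] at hl
        have hw2 : w.2 = 0 := by simpa [P, ha] using hl
        exact hw (Prod.ext h hw2)
      refine ⟨w.2 / w.1, ?_, ?_⟩
      · field_simp
        linear_combination hl
      · rw [← p.mk_rep, Projectivization.mk_eq_mk_iff']
        refine ⟨(c * w.1 ^ 3)⁻¹, ?_⟩
        rw [hpw, cubicCurve_eq_smul hw1, map_smul, smul_smul, smul_smul, mul_assoc,
          inv_mul_cancel₀ (mul_ne_zero hc (pow_ne_zero 3 hw1)), one_smul]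
    · rintro ⟨t, ht, rfl⟩
      refine ⟨mk_mem_cubicImage hL (hne t), ?_⟩
      rw [(isHomogeneousPoly_dual l).mk_rep_eq_zero_iff, apply_cubicCurve]
      linear_combination ht
  have hcard := Cubic.card_roots_of_discr_ne_zero (φ := RingHom.id ℂ) ha
    (IsAlgClosed.splits _) hd
  rw [Cubic.map_roots, Polynomial.map_id] at hcard
  rw [hset, hg.encard_image, Set.encard_coe_eq_coe_finsetCard, Cubic.roots, hcard]
  rfl

/-- A rational normal curve of degree three is an irreducible curve of degree three. -/
theorem IsRationalNormalCurve.isIrreducibleCurve {C : Set (ℙ ℂ V)}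
    (hC : IsRationalNormalCurve 3 C) : IsIrreducibleCurve 3 C := by
  obtain ⟨L, hL, rfl⟩ := hC
  refine ⟨⟨isClosed_cubicImage hL, isIrreducible_cubicImage hL⟩, projDim_cubicImage hL, ?_⟩
  obtain ⟨M, hM⟩ := LinearMap.exists_leftInverse_of_injective L (LinearMap.ker_eq_bot.2 hL)
  -- The form `y 3 - y 0` cuts out `t ^ 3 - 1`, whose leading coefficient and discriminant are
  -- non-zero.
  refine (forGeneral_ne_zero (hyperplaneCubic_mem_polyFun (L := L))
    ⟨(LinearMap.proj (R := ℂ) (φ := fun _ => ℂ) 3 - LinearMap.proj (R := ℂ) (φ := fun _ => ℂ) 0) ∘ₗ M,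
      ?_⟩).mono fun l hl =>
    encard_cubicImage_inter hL (left_ne_zero_of_mul hl) (right_ne_zero_of_mul hl)
  have hML (y) : M (L y) = y := LinearMap.congr_fun hM y
  simp [hyperplaneCubic, Cubic.discr, hML]

end RationalNormalCubic

/-! ### Assembly of the main theorem. -/

section MainTheorem

lemma IsCoveredBy.mono {V : Type*} [AddCommGroup V] [Module ℂ V] {n : ℕ}
    {𝒞 𝒟 : Set (ℙ ℂ V) → Prop} {X : Set (ℙ ℂ V)} (h : IsCoveredBy n 𝒞 X)
    (h𝒞 : ∀ C, 𝒞 C → 𝒟 C) : IsCoveredBy n 𝒟 X := by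
  obtain ⟨U, hU, hne, hX⟩ := h
  refine ⟨U, hU, hne, fun p hp hpX => ?_⟩
  obtain ⟨C, hC, hCX, hpC⟩ := hX p hp hpX
  exact ⟨C, h𝒞 C hC, hCX, hpC⟩

lemma three_le_finrank_of_hasJordanRank {J : Type*} [NonAssocCommRing J] [Module ℂ J]
    [SMulCommClass ℂ J J] [FiniteDimensional ℂ J] (hJ : HasJordanRank J 3) :
    3 ≤ Module.finrank ℂ J := by
  obtain ⟨x, hx⟩ := ForGeneral.exists hJ
  exact hx ▸ Submodule.finrank_le _

end MainTheorem

end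

theorem mainTheorem12 {J : Type*} [NonAssocCommRing J] [Module ℂ J] [SMulCommClass ℂ J J]
    [IsScalarTower ℂ J J] [FiniteDimensional ℂ J] [IsCommJordan J]
    (hJ : HasJordanRank J 3) :
    IsCoveredBy 3 (IsRationalNormalCurve 3) (twistedCubic J) ∧
      IsXBar (Module.finrank ℂ J) 3 3 (twistedCubic J) := by
  obtain ⟨τ, hτ, hadj, hnorm⟩ := exists_isCubicTrace J hJ
  have hk := three_le_finrank_of_hasJordanRank hJ
  rw [twistedCubic_eq hadj hnorm]
  refine ⟨hτ.isCoveredBy, by omega, by norm_num, by norm_num, isProjVariety_traceVariety τ,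
    projDim_traceVariety τ, hτ.isNondegenerate,
    hτ.isCoveredBy.mono fun _ => IsRationalNormalCurve.isIrreducibleCurve, ?_⟩
  -- Here `ρ = 1`, `m = 2` and `m' = 0`, so `piBar` equals `2 * C(r + 2, r + 1) = 2 (r + 2)`, the
  -- dimension of the space of Zorn matrices.
  obtain ⟨r, hr⟩ : ∃ r, Module.finrank ℂ J = r + 1 := ⟨_, (Nat.sub_add_cancel (by omega)).symm⟩
  simp only [Module.finrank_prod, Module.finrank_self, piBar, hr]
  norm_num [Nat.choose_succ_self_right]
  ring
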